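/- Let $n\ge 0$, let $X=M_n(\mathbf C)\times\mathbf C^n$, and let $f\in\mathbf C[X]$ be the polynomial $$f(M,v)=\det\,[\,v\ \ Mv\ \ M^2v\ \cdots\ M^{n-1}v\,].$$ Let $D_X$ be the ring of algebraic differential operators on the affine space $X$ (the Weyl algebra in the $n^2+n$ coordinates of $X$) and $D_X[s]=\mathbf C[s]\otimes D_X$. It acts on the free rank one module $\mathbf C[X][s,1/f]\cdot f^s$ by $\partial_i(g\,f^s)=\bigl(\partial_i g+s\,g\,(\partial_i f)/f\bigr)f^s$, and $f^{s+1}$ denotes $f\cdot f^s$. The $b$-function of $f$ is the monic polynomial $b(s)\in\mathbf C[s]$ of minimal degree for which there is $D\in D_X[s]$ with $D f^{s+1}=b(s)f^s$. Then $f$ has a $b$-function, it is unique, and it is divisible in $\mathbf C[s]$ by $$b_1(s)=n!\,(s+1)^n .$$ -/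

import Mathlib

noncomputable section

/-! ### The Weyl algebra -/

/-- The defining relations of the Weyl algebra; `Sum.inl i` stands for `x_i` and `Sum.inr i`
for `∂_i`. -/
inductive WeylRel (A σ : Type*) [CommRing A] :
    FreeAlgebra A (σ ⊕ σ) → FreeAlgebra A (σ ⊕ σ) → Prop
  | x_comm (i j : σ) : WeylRel A σ
      (FreeAlgebra.ι A (Sum.inl i) * FreeAlgebra.ι A (Sum.inl j))
      (FreeAlgebra.ι A (Sum.inl j) * FreeAlgebra.ι A (Sum.inl i))
  | d_comm (i j : σ) : WeylRel A σ
      (FreeAlgebra.ι A (Sum.inr i) * FreeAlgebra.ι A (Sum.inr j))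
      (FreeAlgebra.ι A (Sum.inr j) * FreeAlgebra.ι A (Sum.inr i))
  | d_x_same (i : σ) : WeylRel A σ
      (FreeAlgebra.ι A (Sum.inr i) * FreeAlgebra.ι A (Sum.inl i))
      (FreeAlgebra.ι A (Sum.inl i) * FreeAlgebra.ι A (Sum.inr i) + 1)
  | d_x_ne (i j : σ) (h : i ≠ j) : WeylRel A σ
      (FreeAlgebra.ι A (Sum.inr i) * FreeAlgebra.ι A (Sum.inl j))
      (FreeAlgebra.ι A (Sum.inl j) * FreeAlgebra.ι A (Sum.inr i))

/-- The Weyl algebra over `A` in the variables `σ`. For `A = ℂ` and finite `σ` it is the ring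
`D_X` of algebraic differential operators on the affine space `X = ℂ^σ`; for `A = ℂ[s]` it is
`D_X[s] = ℂ[s] ⊗ D_X`. -/
abbrev WeylAlgebra (A σ : Type*) [CommRing A] : Type _ := RingQuot (WeylRel A σ)

/-! ### Extension of a derivation to a localization -/

section Loc

variable {A P : Type*} (L : Type*) [CommRing A] [CommRing P] [CommRing L] [Algebra A P]
  [Algebra P L] [Algebra A L] [IsScalarTower A P L] (M : Submonoid P) [IsLocalization M L]
  (d d' : Derivation A P P)

/-- The homomorphism `g ↦ g + ε d(g)` from `P` to the dual numbers over `L`. -/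
def taylorHom : P →ₐ[A] TrivSqZeroExt L L where
  toFun g := TrivSqZeroExt.inl (algebraMap P L g) + TrivSqZeroExt.inr (algebraMap P L (d g))
  map_one' := by ext <;> simp
  map_zero' := by ext <;> simp
  map_add' a b := by ext <;> simp [-DualNumber.inr_eq_smul_eps]
  map_mul' a b := by ext <;> simp [-DualNumber.inr_eq_smul_eps, mul_comm]
  commutes' r := by
    ext
    · simp [TrivSqZeroExt.algebraMap_eq_inl', IsScalarTower.algebraMap_apply A P L]
    · simp [TrivSqZeroExt.algebraMap_eq_inl']

theorem isUnit_taylorHom (y : M) : IsUnit (taylorHom L d y) := by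
  rw [TrivSqZeroExt.isUnit_iff_isUnit_fst]
  simpa [taylorHom] using IsLocalization.map_units L y

/-- The extension of `taylorHom` to the localization `L`. -/
def taylorLoc : L →ₐ[A] TrivSqZeroExt L L :=
  IsLocalization.liftAlgHom (M := M) (f := taylorHom L d) (isUnit_taylorHom L M d)

theorem taylorLoc_algebraMap (g : P) :
    taylorLoc L M d (algebraMap P L g) = taylorHom L d g := by
  simp [taylorLoc]

theorem fst_taylorLoc (g : L) : (taylorLoc L M d g).fst = g := by
  have h : ((TrivSqZeroExt.fstHom A L L).comp (taylorLoc L M d)) = AlgHom.id A L := by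
    apply IsLocalization.algHom_ext M
    ext j
    change (taylorLoc L M d (algebraMap _ _ j)).fst = algebraMap P L j
    rw [taylorLoc_algebraMap]
    simp [taylorHom]
  exact DFunLike.congr_fun h g

/-- The derivation of the localization `L` of `P` that extends the derivation `d` of `P`. -/
def derivLoc : Derivation A L L where
  toLinearMap := (TrivSqZeroExt.sndHom L L).restrictScalars A ∘ₗ (taylorLoc L M d).toLinearMap
  map_one_eq_zero' := by simp
  leibniz' a b := by simp [fst_taylorLoc, mul_comm]

theorem derivLoc_algebraMap (g : P) :
    derivLoc L M d (algebraMap P L g) = algebraMap P L (d g) := by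
  change (taylorLoc L M d (algebraMap _ _ g)).snd = _
  rw [taylorLoc_algebraMap]
  simp [taylorHom, -DualNumber.inr_eq_smul_eps]

theorem derivation_eq_of_algebraMap {A P : Type*} (L : Type*) [CommRing A] [CommRing P]
    [CommRing L] [Algebra P L] [Algebra A L] (M : Submonoid P) [IsLocalization M L] {D₁ D₂ : Derivation A L L}
    (h : ∀ g : P, D₁ (algebraMap P L g) = D₂ (algebraMap P L g)) (x : L) : D₁ x = D₂ x := by
  obtain ⟨⟨a, y⟩, hx⟩ := IsLocalization.surj M x
  have e := (congrArg D₁ hx).trans ((h a).trans (congrArg D₂ hx).symm)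
  simp only [Derivation.leibniz, h, add_right_inj, smul_eq_mul] at e
  exact (IsLocalization.map_units L y).mul_left_cancel e

theorem derivLoc_comm (h : ∀ g, d (d' g) = d' (d g)) (x : L) :
    derivLoc L M d (derivLoc L M d' x) = derivLoc L M d' (derivLoc L M d x) := by
  have := derivation_eq_of_algebraMap L M (D₁ := ⁅derivLoc L M d, derivLoc L M d'⁆) (D₂ := 0)
    (fun g => by simp [Derivation.commutator_apply, derivLoc_algebraMap, h]) x
  rw [Derivation.commutator_apply] at this
  exact sub_eq_zero.mp this

end Loc

/-- `d (d'u / u) = d' (du / u)` for commuting derivations `d`, `d'` and a unit `u`. -/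
theorem logDeriv_closed {A L : Type*} [CommRing A] [CommRing L] [Algebra A L]
    (d d' : Derivation A L L) (hd : ∀ x, d (d' x) = d' (d x)) (u w : L) (huw : u * w = 1) :
    d (d' u * w) = d' (d u * w) := by
  have h1 := congrArg d huw
  have h2 := congrArg d' huw
  simp only [Derivation.leibniz, smul_eq_mul, Derivation.map_one_eq_zero] at h1 h2
  simp only [Derivation.leibniz, smul_eq_mul, hd u]
  linear_combination (d' u * w) * h1 - (d u * w) * h2 -
    (d' u * d w - d u * d' w) * huw

/-! ### The module `ℂ[x, s, 1/f] · f^s` -/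

section FPow

variable {σ : Type*} (f : MvPolynomial σ ℂ)

/-- `f`, regarded as an element of `ℂ[s][x]`. -/
def withS : MvPolynomial σ (Polynomial ℂ) := MvPolynomial.map Polynomial.C f

/-- `ℂ[x, s, 1/f]`. An element `g` represents the element `g · f^s` of the free module of rank one
generated by the symbol `f^s`. -/
abbrev FsModule : Type _ := Localization.Away (withS f)

/-- `f` as an element of `ℂ[x, s, 1/f]`. -/
def fLoc : FsModule f := algebraMap (MvPolynomial σ (Polynomial ℂ)) (FsModule f) (withS f)

/-- `1/f` in `ℂ[x, s, 1/f]`. -/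
def fLocInv : FsModule f := IsLocalization.Away.invSelf (withS f)

theorem fLoc_mul_fLocInv : fLoc f * fLocInv f = 1 :=
  IsLocalization.Away.mul_invSelf (withS f)

/-- The derivation `∂/∂x_i` of `ℂ[x, s, 1/f]`. -/
def locDeriv (i : σ) : Derivation (Polynomial ℂ) (FsModule f) (FsModule f) :=
  derivLoc (FsModule f) (Submonoid.powers (withS f)) (MvPolynomial.pderiv i)

theorem locDeriv_algebraMap (i : σ) (g : MvPolynomial σ (Polynomial ℂ)) :
    locDeriv f i (algebraMap _ _ g) = algebraMap _ _ (MvPolynomial.pderiv i g) :=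
  derivLoc_algebraMap _ _ _ g

theorem pderiv_comm {A : Type*} [CommRing A] (i j : σ) (g : MvPolynomial σ A) :
    MvPolynomial.pderiv i (MvPolynomial.pderiv j g) =
      MvPolynomial.pderiv j (MvPolynomial.pderiv i g) := by
  classical
  have h : ⁅(MvPolynomial.pderiv i : Derivation A (MvPolynomial σ A) (MvPolynomial σ A)),
      (MvPolynomial.pderiv j : Derivation A (MvPolynomial σ A) (MvPolynomial σ A))⁆ = 0 := by
    apply MvPolynomial.derivation_ext
    intro k
    rw [Derivation.commutator_apply]
    simp only [MvPolynomial.pderiv_X, Pi.single_apply]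
    split_ifs <;> simp
  have := DFunLike.congr_fun h g
  rw [Derivation.commutator_apply] at this
  exact sub_eq_zero.mp this

theorem locDeriv_comm (i j : σ) (g : FsModule f) :
    locDeriv f i (locDeriv f j g) = locDeriv f j (locDeriv f i g) :=
  derivLoc_comm _ _ _ _ (pderiv_comm i j) g

/-- The logarithmic derivative `(∂f/∂x_i) / f`. -/
def fLogDeriv (i : σ) : FsModule f := locDeriv f i (fLoc f) * fLocInv f

theorem locDeriv_fLogDeriv (i j : σ) :
    locDeriv f i (fLogDeriv f j) = locDeriv f j (fLogDeriv f i) :=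
  logDeriv_closed _ _ (locDeriv_comm f i j) _ _ (fLoc_mul_fLocInv f)

/-- Multiplication by `x_i`, as an operator on `ℂ[x, s, 1/f] · f^s`. -/
def xOp (i : σ) : Module.End (Polynomial ℂ) (FsModule f) :=
  LinearMap.mulLeft (Polynomial ℂ)
    (algebraMap (MvPolynomial σ (Polynomial ℂ)) (FsModule f) (MvPolynomial.X i))

/-- `∂_i` as an operator on `ℂ[x, s, 1/f] · f^s`, that is,
`∂_i (g · f^s) = (∂g/∂x_i + s g (∂f/∂x_i) / f) · f^s`. -/
def dOp (i : σ) : Module.End (Polynomial ℂ) (FsModule f) :=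
  (locDeriv f i).toLinearMap +
    (Polynomial.X : Polynomial ℂ) • LinearMap.mulLeft (Polynomial ℂ) (fLogDeriv f i)

theorem xOp_apply (i : σ) (g : FsModule f) :
    xOp f i g =
      algebraMap (MvPolynomial σ (Polynomial ℂ)) (FsModule f) (MvPolynomial.X i) * g := rfl

theorem dOp_apply (i : σ) (g : FsModule f) :
    dOp f i g =
      locDeriv f i g + (Polynomial.X : Polynomial ℂ) • (fLogDeriv f i * g) := rfl

/-- The action of `D_X[s]` on `ℂ[x, s, 1/f] · f^s`. -/
def weylAction : WeylAlgebra (Polynomial ℂ) σ →ₐ[Polynomial ℂ]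
    Module.End (Polynomial ℂ) (FsModule f) :=
  RingQuot.liftAlgHom (Polynomial ℂ)
    ⟨FreeAlgebra.lift (Polynomial ℂ) (Sum.elim (xOp f) (dOp f)), by
      intro a b h
      induction h with
      | x_comm i j =>
        ext g
        simp [xOp_apply, mul_left_comm]
      | d_comm i j =>
        ext g
        simp only [map_mul, FreeAlgebra.lift_ι_apply, Sum.elim_inr, Module.End.mul_apply,
          dOp_apply, map_add, Derivation.map_smul, Derivation.leibniz, smul_eq_mul,
          smul_add, mul_smul_comm, locDeriv_fLogDeriv f i j, locDeriv_comm f i j,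
          mul_left_comm (fLogDeriv f i) (fLogDeriv f j), mul_comm g]
        abel
      | d_x_same i =>
        ext g
        simp only [map_mul, map_add, map_one, FreeAlgebra.lift_ι_apply, Sum.elim_inr,
          Sum.elim_inl, Module.End.mul_apply, LinearMap.add_apply, Module.End.one_apply,
          xOp_apply, dOp_apply, Derivation.leibniz, smul_eq_mul, locDeriv_algebraMap,
          MvPolynomial.pderiv_X_self, mul_smul_comm, mul_one,
          mul_left_comm (fLogDeriv f i)]
        abel
      | d_x_ne i j hij =>
        ext g
        simp only [map_mul, FreeAlgebra.lift_ι_apply, Sum.elim_inr,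
          Sum.elim_inl, Module.End.mul_apply,
          xOp_apply, dOp_apply, Derivation.leibniz, smul_eq_mul, locDeriv_algebraMap,
          MvPolynomial.pderiv_X_of_ne hij.symm, map_zero, mul_zero, add_zero, mul_add,
          mul_smul_comm, mul_left_comm (fLogDeriv f i)]⟩

/-- `b(s)` satisfies a Bernstein equation `D f^{s+1} = b(s) f^s` for some `D` in `D_X[s]`.
Here `f^{s+1} = f · f^s` and `f^s = 1 · f^s`. -/
def SatisfiesBernsteinEquation (b : Polynomial ℂ) : Prop :=
  ∃ D : WeylAlgebra (Polynomial ℂ) σ, weylAction f D (fLoc f) = b • (1 : FsModule f)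

/-- `b` is the Bernstein-Sato `b`-function of `f`: the monic polynomial of minimal degree that
satisfies a Bernstein equation for `f`. -/
structure IsBFunction (b : Polynomial ℂ) : Prop where
  monic : b.Monic
  equation : SatisfiesBernsteinEquation f b
  minimal : ∀ c : Polynomial ℂ, c.Monic → SatisfiesBernsteinEquation f c →
    b.natDegree ≤ c.natDegree

end FPow

/-! ### The function `f(M, v) = det [v  Mv  M²v  …  M^{n-1}v]` -/

/-- The coordinates on `M_n(ℂ) × ℂ^n`: matrix entries and vector entries. -/
abbrev PairCoord (n : ℕ) : Type := (Fin n × Fin n) ⊕ Fin n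

/-- The generic `n × n` matrix `M`. -/
def genericMatrix (n : ℕ) : Matrix (Fin n) (Fin n) (MvPolynomial (PairCoord n) ℂ) :=
  Matrix.of fun i j => MvPolynomial.X (Sum.inl (i, j))

/-- The generic vector `v`. -/
def genericVector (n : ℕ) : Fin n → MvPolynomial (PairCoord n) ℂ :=
  fun i => MvPolynomial.X (Sum.inr i)

/-- The matrix `C(M, v)` whose column with index `j = 0, …, n - 1` is `M^j v`. -/
def cyclicMatrix (n : ℕ) : Matrix (Fin n) (Fin n) (MvPolynomial (PairCoord n) ℂ) :=
  Matrix.of fun i j => (genericMatrix n ^ (j : ℕ)).mulVec (genericVector n) i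

/-- The polynomial function `f(M, v) = det C(M, v)` on `M_n(ℂ) × ℂ^n`. -/
def cyclicDet (n : ℕ) : MvPolynomial (PairCoord n) ℂ := (cyclicMatrix n).det

/-- `b₁(s) = n! (s + 1)^n`. -/
def bOne (n : ℕ) : Polynomial ℂ :=
  Polynomial.C (n.factorial : ℂ) * (Polynomial.X + 1) ^ n

end

/-! Existence and uniqueness. The polynomials that satisfy a Bernstein equation form an ideal of the
principal ideal domain `ℂ[s]`, so only a nonzero member is needed
(`exists_satisfiesBernsteinEquation`). Over `K = ℂ(s)`, let the Weyl algebra act on `K(x)` with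
`∂_i` twisted by `f^s`. The cyclic submodules generated by the `f^i` decrease with `i`. Filtering by
pole order and degree gives growth of order `j^N` in `N` variables, while by Bernstein's inequality
(`pow_le_finrank_mul_finrank`) every nonzero subquotient grows at least that fast. The chain
therefore cannot decrease strictly forever (`exists_eq_succ_of_growth`), and some `f^i` lies in the
module generated by `f^(i+1)`. Clearing denominators in `ℂ(s)` and replacing `s` by `s + i` gives a
Bernstein equation.

Divisibility. Over a finite extension `L` of the field of rational functions in the entries of `M`,
the generic matrix is `P diag(μ) P⁻¹` with distinct `μ_k`. In the coordinates `v = P w` one gets `f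
= u ∏ w_k`, where `u = det P · det Vandermonde(μ)` is a nonzero constant of `L`: generically `f` is
a normal crossing of `n` hyperplanes. Consider Laurent polynomials in `w` over `L[s]` whose `w^a`
coefficient is divisible by `(s+1)` to the number of negative coordinates of `a`. This subring is
stable under the partial derivatives, because differentiating `w_i^0` gives `0` and so opens no new
pole, and it contains `(s+1) ∂f/f`. Since `∂(h f^{s+1}) = (∂h + (s+1) h ∂f/f) f^{s+1}`, everything
that `D_X[s]` produces from `f^{s+1}` has the form `h f^{s+1}` with `h` in the subring
(`mem_of_satisfiesBernsteinEquation`). For `b f^s` this says that `b/f = b u⁻¹ w^(-1,…,-1)` lies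
there, hence `(s+1)^n` divides `b`. The factor `n!` is a unit. -/

noncomputable section

/-! ### Derivations on localizations and induction on the Weyl algebra -/

/-- A ring homomorphism out of a localization intertwines two derivations as soon as it does so on
the elements of the base ring. -/
theorem map_derivation_of_isLocalization {A P L L' : Type*} [CommRing A]
    [CommRing P] [CommRing L] [CommRing L'] [Algebra P L] [Algebra A L]
    (M : Submonoid P) [IsLocalization M L] (D : Derivation A L L) {D' : L' → L'}
    (hD' : ∀ a b, D' (a * b) = a * D' b + b * D' a) (Θ : L →+* L')
    (h : ∀ g : P, Θ (D (algebraMap P L g)) = D' (Θ (algebraMap P L g))) (x : L) :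
    Θ (D x) = D' (Θ x) := by
  obtain ⟨⟨a, y⟩, hx⟩ := IsLocalization.surj M x
  have e := congrArg (fun z => Θ (D z)) hx
  have e' := congrArg (fun z => D' (Θ z)) hx
  have hy := h y
  simp only [Derivation.leibniz, hD', h, smul_eq_mul, map_add, map_mul] at e e'
  have hu := (IsLocalization.map_units L y).map Θ
  apply hu.mul_left_cancel
  linear_combination e - e'

theorem WeylAlgebra.induction {A σ : Type*} [CommRing A] {C : WeylAlgebra A σ → Prop}
    (algebraMap : ∀ r : A, C (algebraMap A _ r))
    (x : ∀ i : σ, C (RingQuot.mkAlgHom A (WeylRel A σ) (FreeAlgebra.ι A (Sum.inl i))))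
    (d : ∀ i : σ, C (RingQuot.mkAlgHom A (WeylRel A σ) (FreeAlgebra.ι A (Sum.inr i))))
    (add : ∀ a b, C a → C b → C (a + b)) (mul : ∀ a b, C a → C b → C (a * b))
    (W : WeylAlgebra A σ) : C W := by
  obtain ⟨w, rfl⟩ := RingQuot.mkAlgHom_surjective A (WeylRel A σ) W
  induction w using FreeAlgebra.induction with
  | grade0 r => simpa using algebraMap r
  | grade1 i =>
    rcases i with i | i
    · exact x i
    · exact d i
  | mul a b ha hb => rw [map_mul]; exact mul _ _ ha hb
  | add a b ha hb => rw [map_add]; exact add _ _ ha hb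

/-! ### The action on `f^s` and the ideal of Bernstein polynomials -/

section Action

variable {σ : Type*} (f : MvPolynomial σ ℂ)

theorem weylAction_x (i : σ) :
    weylAction f (RingQuot.mkAlgHom (Polynomial ℂ) (WeylRel (Polynomial ℂ) σ)
      (FreeAlgebra.ι (Polynomial ℂ) (Sum.inl i))) = xOp f i := by
  simp [weylAction]

theorem weylAction_d (i : σ) :
    weylAction f (RingQuot.mkAlgHom (Polynomial ℂ) (WeylRel (Polynomial ℂ) σ)
      (FreeAlgebra.ι (Polynomial ℂ) (Sum.inr i))) = dOp f i := by
  simp [weylAction]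

/-- A `ℂ[s]`-submodule stable under the generators is stable under `D_X[s]`. -/
theorem weylAction_mem {N : Submodule (Polynomial ℂ) (FsModule f)}
    (hx : ∀ i, ∀ g ∈ N, xOp f i g ∈ N) (hd : ∀ i, ∀ g ∈ N, dOp f i g ∈ N)
    (W : WeylAlgebra (Polynomial ℂ) σ) : ∀ g ∈ N, weylAction f W g ∈ N := by
  induction W using WeylAlgebra.induction with
  | algebraMap r =>
    intro g hg
    simpa using N.smul_mem r hg
  | x i => simpa only [weylAction_x] using hx i
  | d i => simpa only [weylAction_d] using hd i
  | add a b ha hb =>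
    intro g hg
    simpa using N.add_mem (ha g hg) (hb g hg)
  | mul a b ha hb =>
    intro g hg
    simpa using ha _ (hb g hg)

/-- The ideal of all `b` that satisfy a Bernstein equation. -/
def bernsteinIdeal : Ideal (Polynomial ℂ) where
  carrier := {b | SatisfiesBernsteinEquation f b}
  zero_mem' := ⟨0, by simp⟩
  add_mem' := by
    rintro a b ⟨D, hD⟩ ⟨E, hE⟩
    exact ⟨D + E, by simp [hD, hE, add_smul]⟩
  smul_mem' := by
    rintro c b ⟨D, hD⟩
    exact ⟨c • D, by simp [hD, smul_smul]⟩

/-- Since `ℂ[s]` is principal, the `b`-function is the normalized generator of `bernsteinIdeal`. The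
given `b` only serves to make that generator nonzero. -/
theorem existsUnique_isBFunction {b : Polynomial ℂ} (hb : b ≠ 0)
    (h : SatisfiesBernsteinEquation f b) : ∃! b : Polynomial ℂ, IsBFunction f b := by
  classical
  let I := bernsteinIdeal f
  have hI : ∀ {c}, c ∈ I ↔ SatisfiesBernsteinEquation f c := Iff.rfl
  let g := Submodule.IsPrincipal.generator I
  have hmem : ∀ {c}, c ∈ I ↔ g ∣ c := fun {c} => Submodule.IsPrincipal.mem_iff_generator_dvd I
  have hg : g ≠ 0 := by
    intro h0
    exact hb (zero_dvd_iff.1 (h0 ▸ hmem.1 (hI.2 h)))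
  have hdvd : ∀ {c}, SatisfiesBernsteinEquation f c ↔ normalize g ∣ c := fun {c} =>
    hI.symm.trans (hmem.trans normalize_dvd_iff.symm)
  have hmon : (normalize g).Monic := Polynomial.monic_normalize hg
  refine ⟨normalize g, ⟨hmon, hdvd.2 dvd_rfl, fun c hc h =>
    Polynomial.natDegree_le_of_dvd (hdvd.1 h) hc.ne_zero⟩, ?_⟩
  rintro c ⟨hc, hc', hmin⟩
  refine (Polynomial.eq_of_monic_of_dvd_of_natDegree_le hmon hc (hdvd.1 hc')
    (hmin _ hmon (hdvd.2 dvd_rfl)))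

end Action

/-! ### Normally ordered operators and their symbols -/

section NormalOrder

variable {K : Type*} [Field K]

open scoped IsMulCommutative in
-- The subalgebra generated by commuting elements is commutative, so polynomials can be evaluated
-- inside it.
theorem exists_mvPolynomial_algHom_of_commute {τ A : Type*} [Ring A] [Algebra K A] (a : τ → A)
    (h : ∀ i j, a i * a j = a j * a i) :
    ∃ φ : MvPolynomial τ K →ₐ[K] A, ∀ i, φ (MvPolynomial.X i) = a i := by
  have hc : ∀ y ∈ Set.range a, ∀ z ∈ Set.range a, y * z = z * y := by
    rintro _ ⟨i, rfl⟩ _ ⟨j, rfl⟩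
    exact h i j
  have := Algebra.isMulCommutative_adjoin K hc
  let ψ : MvPolynomial τ K →ₐ[K] Algebra.adjoin K (Set.range a) :=
    MvPolynomial.aeval fun i => ⟨a i, Algebra.subset_adjoin ⟨i, rfl⟩⟩
  refine ⟨(Algebra.adjoin K (Set.range a)).val.comp ψ, fun i => ?_⟩
  simp [ψ]

variable {σ E : Type*} [AddCommGroup E] [Module K E]

/-- Operators satisfying the relations of the Weyl algebra. -/
structure IsWeylPair (x d : σ → Module.End K E) : Prop where
  x_comm : ∀ i j, x i * x j = x j * x i
  d_comm : ∀ i j, d i * d j = d j * d i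
  d_x_same : ∀ i, d i * x i = x i * d i + 1
  d_x_ne : ∀ i j, i ≠ j → d i * x j = x j * d i

variable {x d : σ → Module.End K E}

/-- The normally ordered quantization `x^a ξ^b ↦ x^a d^b` of symbols. -/
theorem exists_normalOrder (h : IsWeylPair x d) :
    ∃ q : MvPolynomial (σ ⊕ σ) K →ₗ[K] Module.End K E, q 1 = 1 ∧
      (∀ p i, q (p * MvPolynomial.X (Sum.inl i)) = x i * q p) ∧
      (∀ p i, q (p * MvPolynomial.X (Sum.inr i)) = q p * d i) := by
  -- Although `x_i` and `d_i` do not commute, left multiplication by `x_i` and right multiplication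
  -- by `d_j` do. So polynomials act on `Module.End K E`, and `q p` is the result of applying `p` to
  -- `1`.
  obtain ⟨φ, hφ⟩ := exists_mvPolynomial_algHom_of_commute (K := K)
    (A := Module.End K (Module.End K E))
    (Sum.elim (fun i => LinearMap.mulLeft K (x i)) fun i => LinearMap.mulRight K (d i)) (by
      rintro (i | i) (j | j) <;> ext1 y <;>
        simp only [Sum.elim_inl, Sum.elim_inr, Module.End.mul_apply, LinearMap.mulLeft_apply,
          LinearMap.mulRight_apply, mul_assoc]
      · rw [← mul_assoc, ← mul_assoc, h.x_comm]
      · rw [h.d_comm])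
  refine ⟨(LinearMap.applyₗ (1 : Module.End K E)).comp φ.toLinearMap, ?_, ?_, ?_⟩
  · simp
  · intro p i
    simp only [LinearMap.comp_apply, AlgHom.toLinearMap_apply, LinearMap.applyₗ_apply_apply]
    rw [mul_comm, map_mul, hφ]
    simp
  · intro p i
    simp only [LinearMap.comp_apply, AlgHom.toLinearMap_apply, LinearMap.applyₗ_apply_apply]
    rw [mul_comm, map_mul, hφ]
    simp

variable {q : MvPolynomial (σ ⊕ σ) K →ₗ[K] Module.End K E}

/-- Commutators with the generators are partial derivatives of the symbol. This identity and
`d_mul_normalOrder` are what lower degrees in the proof of faithfulness. -/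
theorem normalOrder_mul_x (h : IsWeylPair x d) (h1 : q 1 = 1)
    (hx : ∀ p i, q (p * MvPolynomial.X (Sum.inl i)) = x i * q p)
    (hd : ∀ p i, q (p * MvPolynomial.X (Sum.inr i)) = q p * d i)
    (p : MvPolynomial (σ ⊕ σ) K) (i : σ) :
    q p * x i = x i * q p + q (MvPolynomial.pderiv (Sum.inr i) p) := by
  classical
  induction p using MvPolynomial.induction_on with
  | C a =>
    have : q (MvPolynomial.C a) = a • 1 := by
      rw [← h1, ← map_smul, MvPolynomial.smul_eq_C_mul, mul_one]
    simp [this]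
  | add p r hp hr => rw [map_add, add_mul, hp, hr]; simp only [map_add, mul_add]; abel
  | mul_X p j hp =>
    rcases j with j | j
    · rw [hx, mul_assoc, hp, Derivation.leibniz, MvPolynomial.pderiv_X_of_ne (by simp)]
      rw [smul_zero, zero_add, smul_eq_mul, mul_comm (MvPolynomial.X _), hx, mul_add, ← mul_assoc, ← mul_assoc, h.x_comm]
    · rw [hd, Derivation.leibniz, smul_eq_mul, smul_eq_mul, map_add,
        mul_comm (MvPolynomial.X _), hd]
      rcases eq_or_ne j i with rfl | hj
      · rw [MvPolynomial.pderiv_X_self, mul_one, mul_assoc, h.d_x_same, mul_add, ← mul_assoc, hp]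
        noncomm_ring
      · rw [MvPolynomial.pderiv_X_of_ne (by simpa using hj), mul_assoc, h.d_x_ne _ _ hj,
          ← mul_assoc, hp]
        simp only [mul_zero, map_zero]
        noncomm_ring

theorem d_mul_normalOrder (h : IsWeylPair x d) (h1 : q 1 = 1)
    (hx : ∀ p i, q (p * MvPolynomial.X (Sum.inl i)) = x i * q p)
    (hd : ∀ p i, q (p * MvPolynomial.X (Sum.inr i)) = q p * d i)
    (p : MvPolynomial (σ ⊕ σ) K) (i : σ) :
    d i * q p = q p * d i + q (MvPolynomial.pderiv (Sum.inl i) p) := by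
  classical
  induction p using MvPolynomial.induction_on with
  | C a =>
    have : q (MvPolynomial.C a) = a • 1 := by
      rw [← h1, ← map_smul, MvPolynomial.smul_eq_C_mul, mul_one]
    simp [this]
  | add p r hp hr => rw [map_add, mul_add, hp, hr]; simp only [map_add, add_mul]; abel
  | mul_X p j hp =>
    rcases j with j | j
    · rw [hx, Derivation.leibniz, smul_eq_mul, smul_eq_mul, map_add,
        mul_comm (MvPolynomial.X _), hx, ← mul_assoc]
      rcases eq_or_ne i j with rfl | hj
      · rw [MvPolynomial.pderiv_X_self, mul_one, h.d_x_same, add_mul, mul_assoc, hp]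
        noncomm_ring
      · rw [MvPolynomial.pderiv_X_of_ne (by simpa using hj.symm), h.d_x_ne _ _ hj, mul_assoc, hp]
        simp only [mul_zero, map_zero]
        noncomm_ring
    · rw [hd, ← mul_assoc, hp, Derivation.leibniz, MvPolynomial.pderiv_X_of_ne (by simp)]
      rw [smul_zero, zero_add, smul_eq_mul, mul_comm (MvPolynomial.X _), hd, add_mul, mul_assoc, mul_assoc, h.d_comm]

variable {Q : ℕ → Submodule K E}

theorem normalOrder_mem (h1 : q 1 = 1)
    (hx : ∀ p i, q (p * MvPolynomial.X (Sum.inl i)) = x i * q p)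
    (hd : ∀ p i, q (p * MvPolynomial.X (Sum.inr i)) = q p * d i)
    (hQ : Monotone Q) (hQx : ∀ j i, ∀ z ∈ Q j, x i z ∈ Q (j + 1))
    (hQd : ∀ j i, ∀ z ∈ Q j, d i z ∈ Q (j + 1)) (p : MvPolynomial (σ ⊕ σ) K) :
    ∀ (m : ℕ), p.totalDegree ≤ m → ∀ j, ∀ z ∈ Q j, q p z ∈ Q (j + m) := by
  have key : ∀ (s : σ ⊕ σ →₀ ℕ) (a : K), ∀ m, (MvPolynomial.monomial s a).totalDegree ≤ m →
      ∀ j, ∀ z ∈ Q j, q (MvPolynomial.monomial s a) z ∈ Q (j + m) := by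
    intro s a
    apply MvPolynomial.induction_on_monomial (motive := fun p => ∀ m, p.totalDegree ≤ m →
      ∀ j, ∀ z ∈ Q j, q p z ∈ Q (j + m))
    · intro a m _ j z hz
      have : q (MvPolynomial.C a) = a • 1 := by
        rw [← h1, ← map_smul, MvPolynomial.smul_eq_C_mul, mul_one]
      simpa [this] using (Q _).smul_mem a (hQ (Nat.le_add_right j m) hz)
    · intro p i hp m hm j z hz
      rcases eq_or_ne p 0 with rfl | hp0
      · simp
      rw [MvPolynomial.totalDegree_mul_of_isDomain hp0 (MvPolynomial.X_ne_zero _),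
        MvPolynomial.totalDegree_X] at hm
      obtain ⟨m, rfl⟩ := Nat.exists_eq_add_one.2 (Nat.zero_lt_of_lt hm)
      have hm' : p.totalDegree ≤ m := by omega
      rcases i with i | i
      · rw [hx]
        exact hQx (j + m) i _ (hp m hm' j z hz)
      · rw [hd, add_comm m, ← add_assoc]
        exact hp m hm' (j + 1) _ (hQd j i z hz)
  intro m hm j z hz
  rw [← p.support_sum_monomial_coeff, map_sum, LinearMap.sum_apply]
  refine Submodule.sum_mem _ fun s hs => key s _ m ?_ j z hz
  exact (MvPolynomial.totalDegree_monomial_le _ _).trans ((MvPolynomial.le_totalDegree hs).trans hm)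

end NormalOrder

/-! ### Bernstein's inequality -/

section BernsteinInequality

variable {K σ E : Type*} [Field K] [CharZero K] [AddCommGroup E] [Module K E]
  {x d : σ → Module.End K E} {q : MvPolynomial (σ ⊕ σ) K →ₗ[K] Module.End K E}
  {Q : ℕ → Submodule K E}

theorem MvPolynomial.totalDegree_pderiv_le {R τ : Type*} [CommSemiring R] (i : τ)
    (p : MvPolynomial τ R) : (MvPolynomial.pderiv i p).totalDegree ≤ p.totalDegree - 1 := by
  classical
  refine Finset.sup_le fun m hm => ?_
  rw [MvPolynomial.mem_support_iff, MvPolynomial.coeff_pderiv] at hm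
  have := MvPolynomial.le_totalDegree (MvPolynomial.mem_support_iff.2 (left_ne_zero_of_mul hm))
  rw [Finsupp.sum_add_index' (by simp) (by simp), Finsupp.sum_single_index rfl] at this
  exact Nat.le_sub_one_of_lt this

theorem MvPolynomial.eq_C_of_pderiv_eq_zero {τ : Type*} {p : MvPolynomial τ K}
    (h : ∀ i, MvPolynomial.pderiv i p = 0) : p = MvPolynomial.C (p.coeff 0) := by
  classical
  ext m
  rw [MvPolynomial.coeff_C]
  split_ifs with hm
  · rw [hm]
  obtain ⟨i, hi⟩ := Finsupp.ne_iff.1 (Ne.symm hm)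
  have hle : Finsupp.single i 1 ≤ m := by
    simpa [Nat.one_le_iff_ne_zero] using hi
  have := congrArg (MvPolynomial.coeff (m - Finsupp.single i 1)) (h i)
  rw [MvPolynomial.coeff_pderiv, tsub_add_cancel_of_le hle, MvPolynomial.coeff_zero] at this
  exact (mul_eq_zero.1 this).resolve_right (Nat.cast_add_one_ne_zero _)

/-- Induction on `m`: if `q p` kills `Q (m + 1)`, its commutators with the generators kill `Q m`, so
every partial derivative of `p` vanishes. In characteristic zero `p` is then a constant that kills a
nonzero vector of `Q 0`. -/
theorem exists_normalOrder_apply_ne_zero (h : IsWeylPair x d) (h1 : q 1 = 1)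
    (hx : ∀ p i, q (p * MvPolynomial.X (Sum.inl i)) = x i * q p)
    (hd : ∀ p i, q (p * MvPolynomial.X (Sum.inr i)) = q p * d i)
    (hQ : Monotone Q) (hQx : ∀ j i, ∀ z ∈ Q j, x i z ∈ Q (j + 1))
    (hQd : ∀ j i, ∀ z ∈ Q j, d i z ∈ Q (j + 1)) (h0 : Q 0 ≠ ⊥) (m : ℕ) :
    ∀ p : MvPolynomial (σ ⊕ σ) K, p.totalDegree ≤ m → (∀ z ∈ Q m, q p z = 0) → p = 0 := by
  have hC : ∀ (a : K), ∀ m, (∀ z ∈ Q m, q (MvPolynomial.C a) z = 0) → a = 0 := by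
    intro a m hz
    obtain ⟨z, hz0, hne⟩ := Submodule.exists_mem_ne_zero_of_ne_bot h0
    have h2 : q (MvPolynomial.C a) = a • 1 := by
      rw [← h1, ← map_smul, MvPolynomial.smul_eq_C_mul, mul_one]
    have := hz z (hQ (Nat.zero_le m) hz0)
    rw [h2] at this
    simpa [hne] using this
  induction m with
  | zero =>
    intro p hp hz
    rw [Nat.le_zero, MvPolynomial.totalDegree_eq_zero_iff_eq_C] at hp
    rw [hp] at hz ⊢
    rw [hC _ _ hz, map_zero]
  | succ m ih =>
    intro p hp hz
    have hpd : ∀ i, MvPolynomial.pderiv i p = 0 := by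
      intro i
      refine ih _ ((MvPolynomial.totalDegree_pderiv_le i p).trans (by omega)) fun z hzm => ?_
      rcases i with i | i
      · have := LinearMap.congr_fun (d_mul_normalOrder h h1 hx hd p i) z
        simpa [hz _ (hQ (Nat.le_succ m) hzm), hz _ (hQd m i z hzm)] using this.symm
      · have := LinearMap.congr_fun (normalOrder_mul_x h h1 hx hd p i) z
        simpa [hz _ (hQ (Nat.le_succ m) hzm), hz _ (hQx m i z hzm)] using this.symm
    have hp' := MvPolynomial.eq_C_of_pderiv_eq_zero hpd
    rw [hp'] at hz ⊢
    rw [hC _ _ hz, map_zero]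

/-- A `2N`-parameter family of operators acts faithfully on a filtered Weyl module. -/
theorem pow_le_finrank_mul_finrank [Fintype σ] (h : IsWeylPair x d)
    (hQ : Monotone Q) (hQx : ∀ j i, ∀ z ∈ Q j, x i z ∈ Q (j + 1))
    (hQd : ∀ j i, ∀ z ∈ Q j, d i z ∈ Q (j + 1)) (h0 : Q 0 ≠ ⊥)
    (hfin : ∀ j, FiniteDimensional K (Q j)) (l : ℕ) :
    (l + 1) ^ (2 * Fintype.card σ) ≤
      Module.finrank K (Q (2 * Fintype.card σ * l)) *
        Module.finrank K (Q (2 * Fintype.card σ * l + 2 * Fintype.card σ * l)) := by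
  classical
  obtain ⟨q, h1, hx, hd⟩ := exists_normalOrder h
  -- A monomial in twice `Fintype.card σ` variables with all exponents at most `l` has total degree
  -- at most `a`.
  let a := 2 * Fintype.card σ * l
  let b : (σ ⊕ σ → Fin (l + 1)) → MvPolynomial (σ ⊕ σ) K := fun e =>
    MvPolynomial.monomial (Finsupp.equivFunOnFinite.symm fun i => (e i : ℕ)) 1
  have hb : LinearIndependent K b := by
    refine (MvPolynomial.basisMonomials (σ ⊕ σ) K).linearIndependent.comp
      (fun e : σ ⊕ σ → Fin (l + 1) => Finsupp.equivFunOnFinite.symm fun i => (e i : ℕ)) ?_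
    intro e e' he
    have := Finsupp.equivFunOnFinite.symm.injective he
    exact funext fun i => Fin.ext (congrFun this i)
  let V := Submodule.span K (Set.range b)
  have hV : ∀ p ∈ V, p.totalDegree ≤ a := by
    have : V ≤ MvPolynomial.restrictTotalDegree (σ ⊕ σ) K a := by
      rw [Submodule.span_le]
      rintro _ ⟨e, rfl⟩
      rw [SetLike.mem_coe, MvPolynomial.mem_restrictTotalDegree]
      refine (MvPolynomial.totalDegree_monomial_le _ _).trans ?_
      rw [Finsupp.sum_fintype _ _ (by simp)]
      refine (Finset.sum_le_card_nsmul _ _ l fun i _ => ?_).trans ?_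
      · simpa using Nat.lt_succ_iff.1 (e i).2
      · simp [a, two_mul]
    exact fun p hp => (MvPolynomial.mem_restrictTotalDegree _ _ _ |>.1 (this hp))
  have hcard : Module.finrank K V = (l + 1) ^ (2 * Fintype.card σ) := by
    rw [finrank_span_eq_card hb]
    simp [two_mul]
  -- Symbols of degree at most `a` embed in `Hom (Q a, Q (2a))`; comparing dimensions gives the
  -- bound.
  let Ψ : V →ₗ[K] (Q a →ₗ[K] Q (a + a)) :=
    { toFun := fun p => LinearMap.codRestrict _ ((q p).domRestrict (Q a)) fun z =>
        normalOrder_mem h1 hx hd hQ hQx hQd _ a (hV p p.2) a z z.2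
      map_add' := fun p r => by
        ext z
        change q (p + r : MvPolynomial (σ ⊕ σ) K) z = q p z + q r z
        rw [map_add, LinearMap.add_apply]
      map_smul' := fun c p => by
        ext z
        change q (c • p : MvPolynomial (σ ⊕ σ) K) z = c • q p z
        rw [map_smul, LinearMap.smul_apply] }
  have hΨ : Function.Injective Ψ := by
    rw [injective_iff_map_eq_zero]
    intro p hp
    apply Subtype.ext
    refine exists_normalOrder_apply_ne_zero h h1 hx hd hQ hQx hQd h0 a _ (hV p p.2) fun z hz => ?_
    exact congrArg Subtype.val (LinearMap.congr_fun hp ⟨z, hz⟩)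
  rw [← hcard, ← Module.finrank_linearMap (S := K) (R := K)]
  exact LinearMap.finrank_le_finrank_of_injective hΨ

end BernsteinInequality

/-! ### Descending chains of Weyl submodules -/

section Chain

variable {K σ E : Type*} [Field K] [AddCommGroup E] [Module K E]

theorem finrank_map_mkQ_inf_add {N N' M : Submodule K E} (h : N' ≤ N) [FiniteDimensional K M] :
    Module.finrank K ((N ⊓ M).map N'.mkQ) + Module.finrank K (N' ⊓ M : Submodule K E) =
      Module.finrank K (N ⊓ M : Submodule K E) := by
  have := Submodule.finiteDimensional_of_le (inf_le_right : N ⊓ M ≤ M)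
  rw [← LinearMap.finrank_range_add_finrank_ker (N'.mkQ.domRestrict (N ⊓ M)),
    LinearMap.range_domRestrict]
  have hker : (N'.mkQ.domRestrict (N ⊓ M)).ker = (N' ⊓ M).comap (N ⊓ M).subtype := by
    ext ⟨z, hz⟩
    simpa using fun _ => hz.2
  rw [hker, (Submodule.comapSubtypeEquivOfLe (inf_le_inf_right M h)).finrank_eq]

variable {x d : σ → Module.End K E}

theorem IsWeylPair.mapQ (h : IsWeylPair x d) (N : Submodule K E)
    (hx : ∀ i, N ≤ N.comap (x i)) (hd : ∀ i, N ≤ N.comap (d i)) :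
    IsWeylPair (fun i => N.mapQ N (x i) (hx i)) (fun i => N.mapQ N (d i) (hd i)) where
  x_comm i j := by
    ext z
    simpa using congrArg N.mkQ (LinearMap.congr_fun (h.x_comm i j) z)
  d_comm i j := by
    ext z
    simpa using congrArg N.mkQ (LinearMap.congr_fun (h.d_comm i j) z)
  d_x_same i := by
    ext z
    simpa using congrArg N.mkQ (LinearMap.congr_fun (h.d_x_same i) z)
  d_x_ne i j hij := by
    ext z
    simpa using congrArg N.mkQ (LinearMap.congr_fun (h.d_x_ne i j hij) z)

/-- A descending chain of Weyl submodules of a module with an exhaustive filtration of growth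
`O(j ^ N)` cannot be strictly decreasing. -/
theorem exists_eq_succ_of_growth [CharZero K] [Fintype σ] (h : IsWeylPair x d)
    {M : ℕ → Submodule K E} (hM : Monotone M)
    (hMx : ∀ j i, ∀ z ∈ M j, x i z ∈ M (j + 1)) (hMd : ∀ j i, ∀ z ∈ M j, d i z ∈ M (j + 1))
    [hfin : ∀ j, FiniteDimensional K (M j)] {C : ℕ}
    (hC : ∀ j, Module.finrank K (M j) ≤ (C * (j + 1)) ^ Fintype.card σ)
    {N : ℕ → Submodule K E} (hN : Antitone N) (hNM : ∀ i, ∀ z ∈ N i, ∃ j, z ∈ M j)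
    (hNx : ∀ k i, N k ≤ (N k).comap (x i)) (hNd : ∀ k i, N k ≤ (N k).comap (d i)) :
    ∃ i, N i = N (i + 1) := by
  by_contra! hne
  have hlt : ∀ i, ∃ z, ∃ j, z ∈ N i ∧ z ∉ N (i + 1) ∧ z ∈ M j := by
    intro i
    obtain ⟨z, hz, hz'⟩ := SetLike.exists_of_lt ((hN (Nat.le_succ i)).lt_of_ne (hne i).symm)
    obtain ⟨j, hj⟩ := hNM i z hz
    exact ⟨z, j, hz, hz', hj⟩
  choose z j hz hz' hzj using hlt
  let n := Fintype.card σ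
  -- One more strict step than the growth bound allows. It depends on `C` and `n` only, so `l` may
  -- be chosen after it.
  let m := (C * (4 * n + 1)) ^ n + 1
  -- `M l` contains a witness for each of the first `m` strict inclusions, so the shifted filtration
  -- of each subquotient starts with a nonzero space.
  let l := (Finset.range m).sup j
  -- The highest level that Bernstein's inequality reaches after the shift by `l`; moreover `J + 1 ≤
  -- (4n + 1)(l + 1)`.
  let J := l + (2 * n * l + 2 * n * l)
  let r : ℕ → ℕ := fun i => Module.finrank K ((N i ⊓ M J).map (N (i + 1)).mkQ)
  have hlow : ∀ i < m, (l + 1) ^ n ≤ r i := by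
    intro i hi
    let Q : ℕ → Submodule K (E ⧸ N (i + 1)) := fun k => (N i ⊓ M (l + k)).map (N (i + 1)).mkQ
    have hQ : Monotone Q := fun k k' hk =>
      Submodule.map_mono (inf_le_inf_left _ (hM (Nat.add_le_add_left hk l)))
    have key := pow_le_finrank_mul_finrank (h.mapQ (N (i + 1)) (hNx _) (hNd _)) hQ
      (by
        rintro k s _ ⟨w, ⟨hw, hw'⟩, rfl⟩
        exact ⟨x s w, ⟨hNx i s hw, hMx _ s w hw'⟩, rfl⟩)
      (by
        rintro k s _ ⟨w, ⟨hw, hw'⟩, rfl⟩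
        exact ⟨d s w, ⟨hNd i s hw, hMd _ s w hw'⟩, rfl⟩)
      (by
        refine Submodule.ne_bot_iff _ |>.2 ⟨(N (i + 1)).mkQ (z i), ⟨z i, ⟨hz i, ?_⟩, rfl⟩, ?_⟩
        · exact hM (Finset.le_sup (Finset.mem_range.2 hi)) (hzj i)
        · simpa using hz' i)
      (fun k => by
        have := Submodule.finiteDimensional_of_le (inf_le_right : N i ⊓ M (l + k) ≤ M (l + k))
        exact Module.Finite.map _ _)
      l
    have hfinJ : FiniteDimensional K (Q (2 * n * l + 2 * n * l)) := by
      have := Submodule.finiteDimensional_of_le (inf_le_right : N i ⊓ M J ≤ M J)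
      exact Module.Finite.map _ _
    have hle : Module.finrank K (Q (2 * n * l)) ≤ r i :=
      Submodule.finrank_mono (hQ (Nat.le_add_right _ _))
    -- Both dimensions in Bernstein's inequality are at most `r i`, and its left side is a square.
    have h2 : ((l + 1) ^ n) ^ 2 ≤ r i ^ 2 := by
      rw [← pow_mul, mul_comm n 2, sq]
      exact key.trans (Nat.mul_le_mul_right _ hle)
    exact (Nat.pow_le_pow_iff_left two_ne_zero).1 h2
  have hup : ∀ k, ∑ i ∈ Finset.range k, r i + Module.finrank K (N k ⊓ M J : Submodule K E) =
      Module.finrank K (N 0 ⊓ M J : Submodule K E) := by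
    intro k
    induction k with
    | zero => simp
    | succ k ih =>
      rw [Finset.sum_range_succ, add_assoc, ← ih]
      congr 1
      exact finrank_map_mkQ_inf_add (hN (Nat.le_succ k))
  have h1 : m * (l + 1) ^ n ≤ ∑ i ∈ Finset.range m, r i := by
    simpa using Finset.card_nsmul_le_sum (Finset.range m) r _
      fun i hi => hlow i (Finset.mem_range.1 hi)
  have h2 : ∑ i ∈ Finset.range m, r i ≤ (C * (J + 1)) ^ n :=
    (le_of_add_le_left (hup m).le).trans
      ((Submodule.finrank_mono inf_le_right).trans (hC J))
  have h3 : (C * (J + 1)) ^ n ≤ (C * (4 * n + 1)) ^ n * (l + 1) ^ n := by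
    rw [← mul_pow, mul_assoc]
    refine Nat.pow_le_pow_left (Nat.mul_le_mul_left C ?_) n
    simp only [J]
    nlinarith
  have h4 : m ≤ (C * (4 * n + 1)) ^ n :=
    Nat.le_of_mul_le_mul_right (h1.trans (h2.trans h3)) (Nat.pow_pos (Nat.succ_pos l))
  simp only [m] at h4
  omega

end Chain

/-! ### Rational functions as a twisted Weyl module -/

section RationalFunctions

variable {K σ : Type*} [Field K]

/-- The derivation `∂/∂x_i` of the field of rational functions. -/
def fracDeriv (K : Type*) {σ : Type*} [Field K] (i : σ) :
    Derivation K (FractionRing (MvPolynomial σ K)) (FractionRing (MvPolynomial σ K)) :=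
  derivLoc (FractionRing (MvPolynomial σ K)) (nonZeroDivisors (MvPolynomial σ K))
    (MvPolynomial.pderiv i)

theorem fracDeriv_algebraMap (i : σ) (g : MvPolynomial σ K) :
    fracDeriv K i (algebraMap (MvPolynomial σ K) (FractionRing (MvPolynomial σ K)) g) =
      algebraMap (MvPolynomial σ K) (FractionRing (MvPolynomial σ K)) (MvPolynomial.pderiv i g) :=
  derivLoc_algebraMap _ _ _ g

theorem fracDeriv_comm (i j : σ) (g : FractionRing (MvPolynomial σ K)) :
    fracDeriv K i (fracDeriv K j g) = fracDeriv K j (fracDeriv K i g) :=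
  derivLoc_comm _ _ _ _ (pderiv_comm i j) g

/-- Multiplication by `x_i` on rational functions. -/
def fracX (K : Type*) {σ : Type*} [Field K] (i : σ) :
    Module.End K (FractionRing (MvPolynomial σ K)) :=
  LinearMap.mulLeft K
    (algebraMap (MvPolynomial σ K) (FractionRing (MvPolynomial σ K)) (MvPolynomial.X i))

/-- The operator `∂_i + α φ⁻¹ ∂_i φ` on rational functions, that is, `∂_i` twisted by `φ^α`. -/
def fracD (α : K) (φ : FractionRing (MvPolynomial σ K)) (i : σ) :
    Module.End K (FractionRing (MvPolynomial σ K)) :=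
  (fracDeriv K i).toLinearMap + α • LinearMap.mulLeft K (fracDeriv K i φ * φ⁻¹)

theorem fracX_apply (i : σ) (g : FractionRing (MvPolynomial σ K)) :
    fracX K i g =
      algebraMap (MvPolynomial σ K) (FractionRing (MvPolynomial σ K)) (MvPolynomial.X i) * g := rfl

theorem fracD_apply (α : K) (φ : FractionRing (MvPolynomial σ K)) (i : σ)
    (g : FractionRing (MvPolynomial σ K)) :
    fracD α φ i g = fracDeriv K i g + α • (fracDeriv K i φ * φ⁻¹ * g) := rfl

/-- The twisted derivatives commute because the logarithmic differential of `φ` is closed. -/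
theorem isWeylPair_frac (α : K) {φ : FractionRing (MvPolynomial σ K)} (hφ : φ ≠ 0) :
    IsWeylPair (fracX K) (fracD α φ) where
  x_comm i j := by
    ext1 g
    simp only [Module.End.mul_apply, fracX_apply]
    ring
  d_comm i j := by
    ext1 g
    have := logDeriv_closed _ _ (fracDeriv_comm i j) φ φ⁻¹ (mul_inv_cancel₀ hφ)
    simp only [Module.End.mul_apply, fracD_apply, map_add, Derivation.map_smul]
    rw [Derivation.leibniz _ (_ * _) g, Derivation.leibniz _ (_ * _) g, this, fracDeriv_comm i j]
    simp only [smul_eq_mul, Algebra.smul_def]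
    ring
  d_x_same i := by
    ext1 g
    simp only [Module.End.mul_apply, fracX_apply, fracD_apply, LinearMap.add_apply,
      Module.End.one_apply, Derivation.leibniz, fracDeriv_algebraMap, MvPolynomial.pderiv_X_self,
      map_one, smul_eq_mul, Algebra.smul_def]
    ring
  d_x_ne i j hij := by
    ext1 g
    simp only [Module.End.mul_apply, fracX_apply, fracD_apply, Derivation.leibniz,
      fracDeriv_algebraMap, MvPolynomial.pderiv_X_of_ne hij.symm, map_zero, smul_eq_mul,
      Algebra.smul_def]
    ring

variable (f : MvPolynomial σ K)

/-- The space of rational functions `g / f^j` with `deg g ≤ j (deg f + 1)`. -/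
def poleFiltration (j : ℕ) : Submodule K (FractionRing (MvPolynomial σ K)) :=
  (MvPolynomial.restrictTotalDegree σ K (j * (f.totalDegree + 1))).map
    ((LinearMap.mulRight K ((algebraMap (MvPolynomial σ K) (FractionRing (MvPolynomial σ K)) f ^ j)⁻¹)).comp
      (IsScalarTower.toAlgHom K (MvPolynomial σ K)
        (FractionRing (MvPolynomial σ K))).toLinearMap)

variable {f}

theorem mem_poleFiltration {j : ℕ} {z : FractionRing (MvPolynomial σ K)} :
    z ∈ poleFiltration f j ↔ ∃ g : MvPolynomial σ K, g.totalDegree ≤ j * (f.totalDegree + 1) ∧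
      algebraMap (MvPolynomial σ K) (FractionRing (MvPolynomial σ K)) g *
        (algebraMap (MvPolynomial σ K) (FractionRing (MvPolynomial σ K)) f ^ j)⁻¹ = z := by
  simp [poleFiltration, MvPolynomial.mem_restrictTotalDegree]

theorem fracDeriv_mul_inv_pow (i : σ) (j : ℕ) (g : FractionRing (MvPolynomial σ K))
    {φ : FractionRing (MvPolynomial σ K)} (hφ : φ ≠ 0) :
    fracDeriv K i (g * (φ ^ j)⁻¹) =
      (φ * fracDeriv K i g - j * (g * fracDeriv K i φ)) * (φ ^ (j + 1))⁻¹ := by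
  rw [Derivation.leibniz, Derivation.leibniz_inv, Derivation.leibniz_pow]
  simp only [smul_eq_mul, nsmul_eq_mul]
  rcases j with - | j
  · field_simp
    simp
  · rw [Nat.add_sub_cancel]
    field_simp
    ring

theorem poleFiltration_le_succ (hf : f ≠ 0) (j : ℕ) :
    poleFiltration f j ≤ poleFiltration f (j + 1) := by
  intro z hz
  obtain ⟨g, hg, rfl⟩ := mem_poleFiltration.1 hz
  have hφ : algebraMap (MvPolynomial σ K) (FractionRing (MvPolynomial σ K)) f ≠ 0 := by simpa using hf
  refine mem_poleFiltration.2 ⟨f * g, (MvPolynomial.totalDegree_mul _ _).trans ?_, ?_⟩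
  · rw [Nat.succ_mul]; omega
  · rw [map_mul, pow_succ]
    field_simp

/-- Passing to denominator `f^(j+1)` costs `deg f` in the numerator and `x_i` costs one more, which
is why the filtration has slope `deg f + 1`. -/
theorem fracX_mem_poleFiltration (hf : f ≠ 0) (j : ℕ) (i : σ)
    {z : FractionRing (MvPolynomial σ K)} (hz : z ∈ poleFiltration f j) :
    fracX K i z ∈ poleFiltration f (j + 1) := by
  obtain ⟨g, hg, rfl⟩ := mem_poleFiltration.1 hz
  have hφ : algebraMap (MvPolynomial σ K) (FractionRing (MvPolynomial σ K)) f ≠ 0 := by simpa using hf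
  refine mem_poleFiltration.2 ⟨f * (MvPolynomial.X i * g),
    (MvPolynomial.totalDegree_mul _ _).trans ?_, ?_⟩
  · have := MvPolynomial.totalDegree_mul (MvPolynomial.X i) g
    rw [MvPolynomial.totalDegree_X] at this
    rw [Nat.succ_mul]; omega
  · rw [map_mul, map_mul, pow_succ, fracX_apply]
    field_simp

/-- By the quotient rule the new numerator over `f^(j+1)` is `f ∂g + (α - j) g ∂f`. -/
theorem fracD_mem_poleFiltration (α : K) (hf : f ≠ 0) (j : ℕ) (i : σ)
    {z : FractionRing (MvPolynomial σ K)} (hz : z ∈ poleFiltration f j) :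
    fracD α (algebraMap (MvPolynomial σ K) (FractionRing (MvPolynomial σ K)) f) i z ∈ poleFiltration f (j + 1) := by
  obtain ⟨g, hg, rfl⟩ := mem_poleFiltration.1 hz
  have hφ : algebraMap (MvPolynomial σ K) (FractionRing (MvPolynomial σ K)) f ≠ 0 := by simpa using hf
  have hg' := MvPolynomial.totalDegree_pderiv_le i g
  have hf' := MvPolynomial.totalDegree_pderiv_le i f
  have h1 := MvPolynomial.totalDegree_mul f (MvPolynomial.pderiv i g)
  have h2 := MvPolynomial.totalDegree_mul g (MvPolynomial.pderiv i f)
  refine mem_poleFiltration.2 ⟨f * MvPolynomial.pderiv i g +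
    (α - (j : K)) • (g * MvPolynomial.pderiv i f), (MvPolynomial.totalDegree_add _ _).trans
      (max_le ?_ ((MvPolynomial.totalDegree_smul_le _ _).trans ?_)), ?_⟩
  · rw [Nat.succ_mul]; omega
  · rw [Nat.succ_mul]; omega
  · rw [fracD_apply, fracDeriv_mul_inv_pow _ _ _ hφ]
    simp only [fracDeriv_algebraMap, map_add, map_mul, Algebra.smul_def, map_sub, map_natCast,
      ← IsScalarTower.algebraMap_apply K (MvPolynomial σ K) (FractionRing (MvPolynomial σ K))]
    field_simp
    ring

theorem finiteDimensional_restrictTotalDegree_and_finrank_le [Fintype σ] (m : ℕ) :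
    FiniteDimensional K (MvPolynomial.restrictTotalDegree σ K m) ∧
      Module.finrank K (MvPolynomial.restrictTotalDegree σ K m) ≤ (m + 1) ^ Fintype.card σ := by
  classical
  let b : (σ → Fin (m + 1)) → MvPolynomial σ K := fun e =>
    MvPolynomial.monomial (Finsupp.equivFunOnFinite.symm fun i => (e i : ℕ)) 1
  have hle : MvPolynomial.restrictTotalDegree σ K m ≤ Submodule.span K (Set.range b) := by
    intro p hp
    rw [MvPolynomial.mem_restrictTotalDegree] at hp
    rw [← p.support_sum_monomial_coeff]
    refine Submodule.sum_mem _ fun s hs => ?_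
    have hs' : ∀ i, s i ≤ m := fun i =>
      (Finsupp.le_degree i s).trans ((MvPolynomial.le_totalDegree hs).trans hp)
    rw [← mul_one (MvPolynomial.coeff s p), ← smul_eq_mul, ← MvPolynomial.smul_monomial]
    refine Submodule.smul_mem _ _ (Submodule.subset_span
      ⟨fun i => ⟨s i, Nat.lt_succ_of_le (hs' i)⟩, ?_⟩)
    exact congrArg (fun t => MvPolynomial.monomial t (1 : K)) (Finsupp.ext fun i => rfl)
  have hfin : FiniteDimensional K (Submodule.span K (Set.range b)) :=
    FiniteDimensional.span_of_finite K (Set.finite_range b)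
  refine ⟨Submodule.finiteDimensional_of_le hle, (Submodule.finrank_mono hle).trans ?_⟩
  exact (finrank_range_le_card b).trans (by simp)

variable [CharZero K] [Finite σ]

/-- Over a field, `φ^i` lies in the Weyl submodule generated by `φ^(i + 1)` for some `i`. -/
theorem exists_adjoin_apply_pow_succ (α : K) (hf : f ≠ 0) :
    ∃ i : ℕ, ∃ P ∈ Algebra.adjoin K
        (Set.range (fracX K) ∪ Set.range (fracD α (algebraMap (MvPolynomial σ K) (FractionRing (MvPolynomial σ K)) f))),
      P (algebraMap (MvPolynomial σ K) (FractionRing (MvPolynomial σ K)) f ^ (i + 1)) =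
        algebraMap (MvPolynomial σ K) (FractionRing (MvPolynomial σ K)) f ^ i := by
  have := Fintype.ofFinite σ
  set φ := algebraMap (MvPolynomial σ K) (FractionRing (MvPolynomial σ K)) f with hφ_def
  have hφ : φ ≠ 0 := by simpa [φ] using hf
  set S := Algebra.adjoin K (Set.range (fracX K) ∪ Set.range (fracD α φ)) with hS
  have hSx : ∀ i, fracX K i ∈ S := fun i => Algebra.subset_adjoin (Or.inl ⟨i, rfl⟩)
  have hSd : ∀ i, fracD α φ i ∈ S := fun i => Algebra.subset_adjoin (Or.inr ⟨i, rfl⟩)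
  have hSmul : ∀ g : MvPolynomial σ K, LinearMap.mulLeft K
      (algebraMap (MvPolynomial σ K) (FractionRing (MvPolynomial σ K)) g) ∈ S := by
    intro g
    induction g using MvPolynomial.induction_on with
    | C a =>
      convert S.algebraMap_mem a using 1
      ext1 z
      simp [Algebra.smul_def, IsScalarTower.algebraMap_apply K (MvPolynomial σ K)
        (FractionRing (MvPolynomial σ K)), MvPolynomial.algebraMap_eq]
    | add p q hp hq =>
      convert S.add_mem hp hq using 1
      ext1 z
      simp [add_mul]
    | mul_X p i hp =>
      convert S.mul_mem hp (hSx i) using 1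
      ext1 z
      simp [fracX_apply]
  have hmono : Monotone (poleFiltration f) := monotone_nat_of_le_succ (poleFiltration_le_succ hf)
  have hS_mem : ∀ P ∈ S, ∀ j, ∀ z ∈ poleFiltration f j, ∃ j', P z ∈ poleFiltration f j' := by
    intro P hP
    induction hP using Algebra.adjoin_induction with
    | mem P hP =>
      rcases hP with ⟨i, rfl⟩ | ⟨i, rfl⟩
      · exact fun j z hz => ⟨_, fracX_mem_poleFiltration hf j i hz⟩
      · exact fun j z hz => ⟨_, fracD_mem_poleFiltration α hf j i hz⟩
    | algebraMap c => exact fun j z hz => ⟨j, by simpa using Submodule.smul_mem _ c hz⟩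
    | add P R _ _ hP hR =>
      intro j z hz
      obtain ⟨a, ha⟩ := hP j z hz
      obtain ⟨b, hb⟩ := hR j z hz
      exact ⟨max a b, Submodule.add_mem _ (hmono (le_max_left a b) ha)
        (hmono (le_max_right a b) hb)⟩
    | mul P R _ _ hP hR =>
      intro j z hz
      obtain ⟨a, ha⟩ := hR j z hz
      exact hP a _ ha
  -- The cyclic module `S φ^i`, which stands for the operators applied to `f^(α+i)`. It decreases
  -- with `i` because multiplication by `φ` belongs to `S`.
  let N : ℕ → Submodule K (FractionRing (MvPolynomial σ K)) := fun i =>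
    (Subalgebra.toSubmodule S).map (LinearMap.applyₗ (φ ^ i))
  have hNmem : ∀ i z, z ∈ N i ↔ ∃ P ∈ S, P (φ ^ i) = z := by
    intro i z
    simp [N]
  have hfin : ∀ j, FiniteDimensional K (poleFiltration f j) := fun j => by
    have := (finiteDimensional_restrictTotalDegree_and_finrank_le (K := K) (σ := σ)
      (j * (f.totalDegree + 1))).1
    exact Module.Finite.map _ _
  obtain ⟨i, hi⟩ := exists_eq_succ_of_growth (isWeylPair_frac α hφ) hmono
    (fun j i z hz => fracX_mem_poleFiltration hf j i hz)
    (fun j i z hz => fracD_mem_poleFiltration α hf j i hz) (C := f.totalDegree + 1)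
    (fun j => by
      have := (finiteDimensional_restrictTotalDegree_and_finrank_le (K := K) (σ := σ)
        (j * (f.totalDegree + 1)))
      have h1 := this.1
      refine (Submodule.finrank_map_le _ _).trans (this.2.trans ?_)
      refine Nat.pow_le_pow_left ?_ _
      nlinarith)
    (N := N)
    (antitone_nat_of_succ_le fun i z hz => by
      obtain ⟨P, hP, rfl⟩ := (hNmem _ _).1 hz
      refine (hNmem _ _).2 ⟨P * LinearMap.mulLeft K φ, S.mul_mem hP (hSmul f), ?_⟩
      rw [Module.End.mul_apply, LinearMap.mulLeft_apply, ← pow_succ'])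
    (fun i z hz => by
      obtain ⟨P, hP, rfl⟩ := (hNmem _ _).1 hz
      refine hS_mem _ (S.mul_mem hP (hSmul (f ^ i))) 0 1 (mem_poleFiltration.2 ⟨1, by simp⟩) |>.imp
        fun j hj => ?_
      simpa using hj)
    (fun k i z hz => by
      obtain ⟨P, hP, rfl⟩ := (hNmem _ _).1 hz
      exact (hNmem _ _).2 ⟨_, S.mul_mem (hSx i) hP, rfl⟩)
    (fun k i z hz => by
      obtain ⟨P, hP, rfl⟩ := (hNmem _ _).1 hz
      exact (hNmem _ _).2 ⟨_, S.mul_mem (hSd i) hP, rfl⟩)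
  refine ⟨i, (hNmem _ _).1 ?_⟩
  rw [← hi]
  exact (hNmem _ _).2 ⟨1, S.one_mem, rfl⟩

end RationalFunctions

/-! ### From operators over `ℂ(s)` to `D_X[s]` -/

section ClearDenominators

variable {σ K : Type*} [Field K] [Algebra ℂ K] (f : MvPolynomial σ ℂ)
  (θ : Polynomial ℂ →ₐ[ℂ] K)

/-- The polynomial `f` as a rational function over the larger field `K`. -/
def fFrac (K : Type*) [Field K] [Algebra ℂ K] : FractionRing (MvPolynomial σ K) :=
  algebraMap (MvPolynomial σ K) (FractionRing (MvPolynomial σ K))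
    (MvPolynomial.map (algebraMap ℂ K) f)

/-- Specialization of the parameter `s` through `θ : ℂ[s] → K`, from `ℂ[s][x]` to `K(x)`. -/
def specialize : MvPolynomial σ (Polynomial ℂ) →+* FractionRing (MvPolynomial σ K) :=
  (algebraMap (MvPolynomial σ K) (FractionRing (MvPolynomial σ K))).comp
    (MvPolynomial.map (θ : Polynomial ℂ →+* K))

theorem specialize_withS : specialize θ (withS f) = fFrac f K := by
  have : (θ : Polynomial ℂ →+* K).comp Polynomial.C = algebraMap ℂ K := by
    ext c
    exact θ.commutes c
  simp [specialize, withS, fFrac, MvPolynomial.map_map, this]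

variable {f}

theorem fFrac_ne_zero (hf : f ≠ 0) : fFrac f K ≠ 0 := by
  have := MvPolynomial.map_injective (σ := σ) _ (algebraMap ℂ K).injective
  simpa [fFrac] using (map_ne_zero_iff _ this).2 hf

/-- Specialization of the parameter `s`, from `ℂ[x, s, 1/f]` to `K(x)`. -/
def specializeLoc (hf : f ≠ 0) : FsModule f →+* FractionRing (MvPolynomial σ K) :=
  IsLocalization.Away.lift (withS f) (g := specialize θ)
    (by rw [specialize_withS]; exact (fFrac_ne_zero hf).isUnit)

theorem specializeLoc_algebraMap (hf : f ≠ 0) (g : MvPolynomial σ (Polynomial ℂ)) :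
    specializeLoc θ hf (algebraMap _ (FsModule f) g) = specialize θ g :=
  IsLocalization.Away.lift_eq _ _ _

theorem specializeLoc_fLoc (hf : f ≠ 0) : specializeLoc θ hf (fLoc f) = fFrac f K := by
  rw [fLoc, specializeLoc_algebraMap, specialize_withS]

theorem specializeLoc_fLocInv (hf : f ≠ 0) : specializeLoc θ hf (fLocInv f) = (fFrac f K)⁻¹ := by
  refine eq_inv_of_mul_eq_one_right ?_
  rw [← specializeLoc_fLoc θ hf, ← map_mul, fLoc_mul_fLocInv, map_one]

theorem specializeLoc_smul (hf : f ≠ 0) (c : Polynomial ℂ) (g : FsModule f) :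
    specializeLoc θ hf (c • g) = θ c • specializeLoc θ hf g := by
  rw [Algebra.smul_def, Algebra.smul_def, map_mul,
    IsScalarTower.algebraMap_apply _ (MvPolynomial σ (Polynomial ℂ)) (FsModule f),
    specializeLoc_algebraMap, IsScalarTower.algebraMap_apply K (MvPolynomial σ K)]
  simp [specialize, MvPolynomial.algebraMap_eq]

theorem specializeLoc_locDeriv (hf : f ≠ 0) (i : σ) (g : FsModule f) :
    specializeLoc θ hf (locDeriv f i g) = fracDeriv K i (specializeLoc θ hf g) := by
  refine map_derivation_of_isLocalization (Submonoid.powers (withS f)) _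
    (fun a b => (fracDeriv K i).leibniz a b) _ (fun g => ?_) g
  rw [locDeriv_algebraMap, specializeLoc_algebraMap, specializeLoc_algebraMap, specialize,
    RingHom.comp_apply, RingHom.comp_apply, fracDeriv_algebraMap, MvPolynomial.pderiv_map]

theorem specializeLoc_injective (hf : f ≠ 0) (hθ : Function.Injective θ) :
    Function.Injective (specializeLoc θ hf) := by
  rw [injective_iff_map_eq_zero]
  intro z hz
  obtain ⟨⟨a, y⟩, hx⟩ := IsLocalization.surj (Submonoid.powers (withS f)) z
  have ha := congrArg (specializeLoc θ hf) hx
  rw [map_mul, hz, zero_mul, specializeLoc_algebraMap] at ha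
  have ha' : a = 0 := by
    refine (MvPolynomial.map_injective (θ : Polynomial ℂ →+* K) hθ) ?_
    refine IsFractionRing.injective (MvPolynomial σ K) (FractionRing (MvPolynomial σ K)) ?_
    rw [map_zero, map_zero]
    exact ha.symm
  simp only [ha', map_zero] at hx
  exact (IsLocalization.map_units (FsModule f) y).mul_left_eq_zero.1 hx

/-- Clearing denominators: a differential operator over `K`, conjugated by `f^i`, is up to a factor
in `ℂ[s]` the specialization of an element of `D_X[s]`. -/
theorem exists_weylAction_specialize (hf : f ≠ 0)
    (hfrac : ∀ c : K, ∃ a b : Polynomial ℂ, b ≠ 0 ∧ θ b * c = θ a) {α : K} (i : ℕ)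
    (hα : θ Polynomial.X = α + i) {P : Module.End K (FractionRing (MvPolynomial σ K))}
    (hP : P ∈ Algebra.adjoin K (Set.range (fracX K) ∪ Set.range (fracD α (fFrac f K)))) :
    ∃ b : Polynomial ℂ, b ≠ 0 ∧ ∃ W : WeylAlgebra (Polynomial ℂ) σ, ∀ g : FsModule f,
      specializeLoc θ hf (weylAction f W g) * fFrac f K ^ i =
        θ b • P (specializeLoc θ hf g * fFrac f K ^ i) := by
  have hφ : fFrac f K ≠ 0 := fFrac_ne_zero hf
  induction hP using Algebra.adjoin_induction with
  | mem P hP =>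
    refine ⟨1, one_ne_zero, ?_⟩
    simp only [map_one, one_smul]
    rcases hP with ⟨k, rfl⟩ | ⟨k, rfl⟩
    · refine ⟨RingQuot.mkAlgHom (Polynomial ℂ) (WeylRel (Polynomial ℂ) σ)
        (FreeAlgebra.ι (Polynomial ℂ) (Sum.inl k)), fun g => ?_⟩
      rw [weylAction_x f k, xOp_apply, map_mul, specializeLoc_algebraMap, fracX_apply, specialize]
      simp [mul_assoc]
    -- Differentiating the factor `f^i` adds `i` to the twist `α`, which matches the value `α + i`
    -- of `s` under `θ`.
    · refine ⟨RingQuot.mkAlgHom (Polynomial ℂ) (WeylRel (Polynomial ℂ) σ)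
        (FreeAlgebra.ι (Polynomial ℂ) (Sum.inr k)), fun g => ?_⟩
      rw [weylAction_d f k, dOp_apply, map_add, specializeLoc_smul, fLogDeriv, map_mul, map_mul,
        specializeLoc_locDeriv, specializeLoc_locDeriv, specializeLoc_fLoc, specializeLoc_fLocInv,
        hα, fracD_apply, Derivation.leibniz, Derivation.leibniz_pow]
      simp only [smul_eq_mul, nsmul_eq_mul, Algebra.smul_def, map_add, map_natCast]
      rcases i with - | i
      · simp
      · rw [Nat.add_sub_cancel]
        field_simp
        ring
  | algebraMap c =>
    obtain ⟨a, b, hb, h⟩ := hfrac c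
    refine ⟨b, hb, algebraMap _ _ a, fun g => ?_⟩
    rw [AlgHom.commutes, Module.algebraMap_end_apply, Module.algebraMap_end_apply,
      specializeLoc_smul, ← h, smul_smul, smul_mul_assoc]
  | add P R _ _ hP hR =>
    obtain ⟨b, hb, W, hW⟩ := hP
    obtain ⟨c, hc, V, hV⟩ := hR
    refine ⟨b * c, mul_ne_zero hb hc, c • W + b • V, fun g => ?_⟩
    rw [map_add, map_smul, map_smul, LinearMap.add_apply, LinearMap.smul_apply,
      LinearMap.smul_apply, map_add, specializeLoc_smul, specializeLoc_smul, add_mul,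
      smul_mul_assoc, smul_mul_assoc, hW, hV, LinearMap.add_apply, smul_add, smul_smul, smul_smul,
      map_mul θ, mul_comm (θ c)]
  | mul P R _ _ hP hR =>
    obtain ⟨b, hb, W, hW⟩ := hP
    obtain ⟨c, hc, V, hV⟩ := hR
    refine ⟨b * c, mul_ne_zero hb hc, W * V, fun g => ?_⟩
    rw [map_mul, Module.End.mul_apply, hW, hV, map_smul, smul_smul, map_mul θ,
      Module.End.mul_apply]

end ClearDenominators

/-- Bernstein's theorem: every nonzero polynomial satisfies a nontrivial Bernstein equation. -/
theorem exists_satisfiesBernsteinEquation {σ : Type*} [Finite σ] {f : MvPolynomial σ ℂ}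
    (hf : f ≠ 0) : ∃ b : Polynomial ℂ, b ≠ 0 ∧ SatisfiesBernsteinEquation f b := by
  let K := FractionRing (Polynomial ℂ)
  have : CharZero K := charZero_of_injective_algebraMap (algebraMap ℂ K).injective
  let α : K := algebraMap (Polynomial ℂ) K Polynomial.X
  have hfK : MvPolynomial.map (algebraMap ℂ K) f ≠ 0 :=
    (map_ne_zero_iff _ (MvPolynomial.map_injective _ (algebraMap ℂ K).injective)).2 hf
  obtain ⟨i, P, hP, hPi⟩ := exists_adjoin_apply_pow_succ α hfK
  -- The operator `P` sends `f^(α+i+1)` to `f^(α+i)`; the substitution `s ↦ s + i` turns this into a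
  -- step from `f^(s+1)` to `f^s`.
  let τ : Polynomial ℂ ≃ₐ[ℂ] Polynomial ℂ := Polynomial.algEquivAevalXAddC (i : ℂ)
  let θ : Polynomial ℂ →ₐ[ℂ] K := (Algebra.ofId (Polynomial ℂ) K).restrictScalars ℂ |>.comp
    τ.toAlgHom
  have hθ : ∀ p, θ p = algebraMap (Polynomial ℂ) K (τ p) := fun p => rfl
  have hinj : Function.Injective θ :=
    (IsFractionRing.injective (Polynomial ℂ) K).comp τ.injective
  have hfrac : ∀ c : K, ∃ a b : Polynomial ℂ, b ≠ 0 ∧ θ b * c = θ a := by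
    intro c
    obtain ⟨⟨a, b⟩, h⟩ := IsLocalization.surj (nonZeroDivisors (Polynomial ℂ)) c
    refine ⟨τ.symm a, τ.symm b, by simp, ?_⟩
    rw [hθ, hθ, AlgEquiv.apply_symm_apply, AlgEquiv.apply_symm_apply, mul_comm]
    exact h
  have hα : θ Polynomial.X = α + i := by
    rw [hθ]
    simp [τ, α]
  obtain ⟨b, hb, W, hW⟩ := exists_weylAction_specialize θ hf hfrac i hα hP
  refine ⟨b, hb, W, specializeLoc_injective θ hf hinj ?_⟩
  have h := hW (fLoc f)
  rw [specializeLoc_fLoc, ← pow_succ'] at h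
  change _ = θ b • P (fFrac f K ^ (i + 1)) at h
  rw [show P (fFrac f K ^ (i + 1)) = fFrac f K ^ i from hPi] at h
  apply mul_right_cancel₀ (pow_ne_zero i (fFrac_ne_zero (K := K) hf))
  rw [h, specializeLoc_smul, map_one, smul_mul_assoc, one_mul]

/-! ### Derivations of Laurent polynomials -/

section LaurentDerivation

variable {A G : Type*} [CommRing A] [AddCommGroup G]

/-- An additive endomorphism satisfying the Leibniz rule. -/
def IsLeibniz {R : Type*} [CommRing R] (D : R →+ R) : Prop :=
  ∀ a b, D (a * b) = a * D b + b * D a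

theorem IsLeibniz.map_one {R : Type*} [CommRing R] {D : R →+ R} (h : IsLeibniz D) : D 1 = 0 := by
  simpa using h 1 1

theorem IsLeibniz.map_pow_eq_zero {R : Type*} [CommRing R] {D : R →+ R} (h : IsLeibniz D) {t : R}
    (ht : D t = 0) (k : ℕ) : D (t ^ k) = 0 := by
  induction k with
  | zero => rw [pow_zero, h.map_one]
  | succ k ih => rw [pow_succ, h, ih, ht, mul_zero, mul_zero, add_zero]

/-- The derivation of a group algebra that restricts to `δ` on scalars and whose logarithmic
derivative on the monomial of exponent `a` is `Λ a`. -/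
def groupAlgebraDeriv (δ : A →+ A) (Λ : G →+ AddMonoidAlgebra A G) :
    AddMonoidAlgebra A G →+ AddMonoidAlgebra A G :=
  (Finsupp.liftAddHom fun a => (AddMonoidAlgebra.singleAddHom a).comp δ +
    (AddMonoidHom.mulRight (Λ a)).comp (AddMonoidAlgebra.singleAddHom a)).comp
      AddMonoidAlgebra.coeffAddEquiv.toAddMonoidHom

theorem groupAlgebraDeriv_single (δ : A →+ A) (Λ : G →+ AddMonoidAlgebra A G) (a : G)
    (r : A) : groupAlgebraDeriv δ Λ (AddMonoidAlgebra.single a r) =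
      AddMonoidAlgebra.single a (δ r) + AddMonoidAlgebra.single a r * Λ a := by
  simp [groupAlgebraDeriv]

/-- On products of monomials the rule reduces to the Leibniz rule for `δ` and the additivity of `Λ`.
-/
theorem isLeibniz_groupAlgebraDeriv {δ : A →+ A} (hδ : IsLeibniz δ)
    (Λ : G →+ AddMonoidAlgebra A G) : IsLeibniz (groupAlgebraDeriv δ Λ) := by
  intro p q
  induction p using AddMonoidAlgebra.induction_linear with
  | zero => simp
  | add p p' hp hp' =>
    simp only [add_mul, map_add, hp, hp', mul_add]
    abel
  | single a r =>
    induction q using AddMonoidAlgebra.induction_linear with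
    | zero => simp
    | add p p' hp hp' =>
      simp only [add_mul, map_add, hp, hp', mul_add]
      abel
    | single b s =>
      simp only [AddMonoidAlgebra.single_mul_single, groupAlgebraDeriv_single, mul_add, hδ r s,
        map_add, AddMonoidAlgebra.single_add, ← mul_assoc]
      rw [add_comm b a, mul_comm s r]
      abel

end LaurentDerivation

/-! ### Laurent polynomials whose poles are paid for by powers of `t` -/

section PoleSubring

variable {A ι : Type*} [CommRing A] [Fintype ι]

/-- The number of negative coordinates. -/
def negCount (a : ι → ℤ) : ℕ := (Finset.univ.filter fun i => a i < 0).card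

theorem negCount_eq_zero {a : ι → ℤ} (h : 0 ≤ a) : negCount a = 0 := by
  simpa [negCount, Finset.filter_eq_empty_iff] using fun i => h i

theorem negCount_add_le (a b : ι → ℤ) : negCount (a + b) ≤ negCount a + negCount b := by
  classical
  refine (Finset.card_le_card fun i hi => ?_).trans (Finset.card_union_le _ _)
  simp only [Finset.mem_filter, Finset.mem_union, Finset.mem_univ, true_and, Pi.add_apply] at hi ⊢
  omega

theorem negCount_sub_single [DecidableEq ι] {a : ι → ℤ} {i : ι} (h : a i ≠ 0) :
    negCount (a - Pi.single i 1) ≤ negCount a := by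
  refine Finset.card_le_card fun j hj => ?_
  simp only [Finset.mem_filter, Finset.mem_univ, true_and, Pi.sub_apply, Pi.single_apply] at hj ⊢
  split_ifs at hj with hji
  · subst hji
    omega
  · omega

/-- Laurent polynomials in which a pole along `k` of the coordinate hyperplanes comes with a
factor `t ^ k`. -/
def poleSubring (t : A) : Subring (AddMonoidAlgebra A (ι → ℤ)) where
  carrier := {g | ∀ a, t ^ negCount a ∣ g.coeff a}
  zero_mem' a := by simp
  one_mem' a := by
    classical
    rw [AddMonoidAlgebra.one_def, AddMonoidAlgebra.coeff_single, Finsupp.single_apply]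
    split_ifs with h
    · simp [← h, negCount]
    · exact dvd_zero _
  add_mem' hp hq a := by simpa using dvd_add (hp a) (hq a)
  neg_mem' hp a := by simpa using hp a
  mul_mem' {p q} hp hq a := by
    classical
    rw [AddMonoidAlgebra.coeff_mul]
    refine Finset.dvd_sum fun b _ => Finset.dvd_sum fun c _ => ?_
    dsimp only
    split_ifs with h
    · subst h
      exact (pow_dvd_pow t (negCount_add_le b c)).trans
        ((pow_add t _ _).symm ▸ mul_dvd_mul (hp b) (hq c))
    · exact dvd_zero _

theorem mem_poleSubring {t : A} {g : AddMonoidAlgebra A (ι → ℤ)} :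
    g ∈ poleSubring t ↔ ∀ a, t ^ negCount a ∣ g.coeff a := Iff.rfl

theorem single_mem_poleSubring {t : A} {a : ι → ℤ} {r : A} :
    AddMonoidAlgebra.single a r ∈ poleSubring t ↔ t ^ negCount a ∣ r := by
  classical
  rw [mem_poleSubring]
  constructor
  · intro h
    simpa [AddMonoidAlgebra.coeff_single] using h a
  · intro h b
    rw [AddMonoidAlgebra.coeff_single, Finsupp.single_apply]
    split_ifs with hb
    · exact hb ▸ h
    · exact dvd_zero _

/-- The logarithmic derivative `∑ a_i w_i⁻¹ c_i` of the monomial `w^a`, when `w_i` has derivative `c_i`. -/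
def logDerivHom (c : ι → AddMonoidAlgebra A (ι → ℤ)) [DecidableEq ι] :
    (ι → ℤ) →+ AddMonoidAlgebra A (ι → ℤ) where
  toFun a := ∑ i, a i • (AddMonoidAlgebra.single (-Pi.single i 1) 1 * c i)
  map_zero' := by simp
  map_add' a b := by simp [add_smul, Finset.sum_add_distrib]

theorem logDerivHom_apply (c : ι → AddMonoidAlgebra A (ι → ℤ)) [DecidableEq ι] (a : ι → ℤ) :
    logDerivHom c a = ∑ i, a i • (AddMonoidAlgebra.single (-Pi.single i 1) 1 * c i) := rfl

/-- Lowering an exponent `a i` creates a new negative coordinate only if `a i = 0`, and that term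
carries the factor `a i`. The powers of `t` survive `δ` because `δ t = 0`. -/
theorem groupAlgebraDeriv_mem_poleSubring [DecidableEq ι] {t : A} {δ : A →+ A}
    (hL : IsLeibniz δ) (hδ : δ t = 0) {c : ι → AddMonoidAlgebra A (ι → ℤ)} (hc : ∀ i, c i ∈ poleSubring t)
    {g : AddMonoidAlgebra A (ι → ℤ)} (hg : g ∈ poleSubring t) :
    groupAlgebraDeriv δ (logDerivHom c) g ∈ poleSubring t := by
  rw [← AddMonoidAlgebra.sum_coeff_single g, Finsupp.sum, map_sum]
  refine Subring.sum_mem _ fun a _ => ?_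
  have ha := hg a
  rw [groupAlgebraDeriv_single]
  refine Subring.add_mem _ (single_mem_poleSubring.2 ?_) ?_
  · obtain ⟨r, hr⟩ := ha
    rw [hr, hL, hL.map_pow_eq_zero hδ, mul_zero, add_zero]
    exact dvd_mul_right _ _
  · rw [logDerivHom_apply, Finset.mul_sum]
    refine Subring.sum_mem _ fun i _ => ?_
    rcases eq_or_ne (a i) 0 with hi | hi
    · simp [hi]
    · rw [mul_smul_comm, ← mul_assoc, AddMonoidAlgebra.single_mul_single, mul_one, ← sub_eq_add_neg]
      refine Subring.zsmul_mem _ (Subring.mul_mem _ (single_mem_poleSubring.2 ?_) (hc i)) _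
      exact (pow_dvd_pow t (negCount_sub_single hi)).trans ha

/-- The logarithmic derivative of a monomial is a scalar plus terms `w_i⁻¹ c_i`, each with a pole
along one hyperplane only, so a single factor `t` suffices. -/
theorem groupAlgebraDeriv_log_mem_poleSubring [DecidableEq ι] {t : A} (δ : A →+ A)
    {c : ι → AddMonoidAlgebra A (ι → ℤ)} (hc : ∀ i, c i ∈ poleSubring t) {u v : A}
    (huv : u * v = 1) (a : ι → ℤ) :
    AddMonoidAlgebra.single 0 t * (groupAlgebraDeriv δ (logDerivHom c)
      (AddMonoidAlgebra.single a u) * AddMonoidAlgebra.single (-a) v) ∈ poleSubring t := by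
  have h0 : AddMonoidAlgebra.single a u * AddMonoidAlgebra.single (-a) v = 1 := by
    rw [AddMonoidAlgebra.single_mul_single, huv, add_neg_cancel]; rfl
  rw [groupAlgebraDeriv_single, add_mul, mul_right_comm _ (logDerivHom c a), h0, one_mul,
    AddMonoidAlgebra.single_mul_single, add_neg_cancel, mul_add,
    AddMonoidAlgebra.single_mul_single, add_zero, logDerivHom_apply, Finset.mul_sum]
  have hz : negCount (0 : ι → ℤ) = 0 := negCount_eq_zero le_rfl
  refine Subring.add_mem _ (single_mem_poleSubring.2 (by simp [hz])) (Subring.sum_mem _ fun i _ => ?_)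
  rw [mul_smul_comm, ← mul_assoc, AddMonoidAlgebra.single_mul_single, zero_add, mul_one]
  refine Subring.zsmul_mem _ (Subring.mul_mem _ (single_mem_poleSubring.2 ?_) (hc i)) _
  conv_rhs => rw [← pow_one t]
  apply pow_dvd_pow
  refine (Finset.card_le_card fun j hj => ?_).trans (Finset.card_singleton i).le
  by_contra hji
  simp [Pi.single_eq_of_ne (Finset.mem_singleton.not.1 hji)] at hj

end PoleSubring

/-! ### From a Bernstein equation to a bound on poles -/

section Transport

variable {σ R : Type*} [CommRing R] {f : MvPolynomial σ ℂ}

/-- A Bernstein equation for `f` bounds the poles of `b / f` along any subring that contains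
`(s + 1) ∂f / f` and is stable under the derivations. -/
theorem mem_of_satisfiesBernsteinEquation (Θ : MvPolynomial σ (Polynomial ℂ) →+* R) {v : R}
    (hv : Θ (withS f) * v = 1) (D : σ → R →+ R)
    (hL : ∀ i, IsLeibniz (D i))
    (hD : ∀ i g, D i (Θ g) = Θ (MvPolynomial.pderiv i g)) (N : Subring R)
    (hΘ : ∀ g, Θ g ∈ N) (hDN : ∀ i, ∀ g ∈ N, D i g ∈ N)
    (hlog : ∀ i, Θ (MvPolynomial.C (Polynomial.X + 1)) * (D i (Θ (withS f)) * v) ∈ N)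
    {b : Polynomial ℂ} (hb : SatisfiesBernsteinEquation f b) :
    Θ (MvPolynomial.C b) * v ∈ N := by
  have hunit : IsUnit (Θ (withS f)) := IsUnit.of_mul_eq_one v hv
  let Φ : FsModule f →+* R := IsLocalization.Away.lift (withS f) hunit
  have hΦ : ∀ g, Φ (algebraMap _ (FsModule f) g) = Θ g := fun g =>
    IsLocalization.Away.lift_eq (withS f) hunit g
  have hΦD : ∀ i g, Φ (locDeriv f i g) = D i (Φ g) := by
    intro i g
    refine map_derivation_of_isLocalization (Submonoid.powers (withS f)) _ (hL i) _ (fun g => ?_) g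
    rw [locDeriv_algebraMap, hΦ, hΦ, hD]
  have hΦf : Φ (fLoc f) = Θ (withS f) := hΦ _
  have hΦinv : Φ (fLocInv f) = v := by
    apply hunit.mul_left_cancel
    rw [hv, ← hΦf, ← map_mul, fLoc_mul_fLocInv, map_one]
  have hΦsmul : ∀ (c : Polynomial ℂ) g, Φ (c • g) = Θ (MvPolynomial.C c) * Φ g := by
    intro c g
    rw [Algebra.smul_def, map_mul,
      IsScalarTower.algebraMap_apply _ (MvPolynomial σ (Polynomial ℂ)) (FsModule f), hΦ]
    rfl
  -- Writing `g f^s = (g/f) f^(s+1)`, the condition is that the coefficient of `f^(s+1)` lies in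
  -- `N`.
  let N' : Submodule (Polynomial ℂ) (FsModule f) :=
    { carrier := {g | Φ g * v ∈ N}
      zero_mem' := by simp
      add_mem' := fun {p q} hp hq => by
        simpa [add_mul] using N.add_mem hp hq
      smul_mem' := fun c g hg => by
        simpa [hΦsmul, mul_assoc] using N.mul_mem (hΘ _) hg }
  have hN' : ∀ g, g ∈ N' ↔ Φ g * v ∈ N := fun g => Iff.rfl
  obtain ⟨W, hW⟩ := hb
  have key := weylAction_mem f (N := N') (fun i g hg => ?_) (fun i g hg => ?_) W (fLoc f)
    (by rw [hN', hΦf, hv]; exact N.one_mem)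
  · rw [hW, hN', hΦsmul, map_one, mul_one] at key
    exact key
  · rw [hN', xOp_apply, map_mul, hΦ, mul_assoc]
    exact N.mul_mem (hΘ _) hg
  · rw [hN'] at hg ⊢
    -- With `h = g/f`, this is `∂(h f^(s+1)) = (∂h + (s+1) h ∂f/f) f^(s+1)`: dividing by `f` turns
    -- the coefficient `s` into `s + 1`.
    have h1 := N.add_mem (hDN i _ hg) (N.mul_mem (hlog i) hg)
    convert h1 using 1
    have hvD : D i v = -v ^ 2 * D i (Θ (withS f)) := by
      have h2 := congrArg (D i) hv
      rw [hL i, (hL i).map_one] at h2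
      linear_combination v * h2 - D i v * hv
    rw [dOp_apply, map_add, hΦsmul, hΦD, fLogDeriv, map_mul, map_mul, hΦD, hΦf, hΦinv,
      hL i, hvD]
    simp only [map_add, map_one]
    ring

end Transport

/-! ### Diagonalizing the generic matrix -/

section Diagonalization

/-- Separability of a monic polynomial over a domain can be checked after a specialization. -/
theorem Polynomial.separable_map_of_separable_map {A F K : Type*} [CommRing A] [IsDomain A]
    [CharZero A] [Field F] [CharZero F] [Field K] {p : Polynomial A} (hp : p.Monic) (φ : A →+* F)
    (hφ : (p.map φ).Separable) (ψ : A →+* K) (hψ : Function.Injective ψ) :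
    (p.map ψ).Separable := by
  rcases eq_or_ne p.natDegree 0 with h0 | h0
  · rw [Polynomial.eq_one_of_monic_natDegree_zero hp h0, Polynomial.map_one]
    exact Polynomial.separable_one
  -- In characteristic zero the derivative of a monic polynomial keeps its degree under `φ`, so this
  -- resultant commutes with specialization.
  have hr : p.resultant p.derivative ≠ 0 := by
    intro h
    have h1 := Polynomial.resultant_ne_zero _ _ hφ
    rw [Polynomial.natDegree_derivative, hp.natDegree_map, ← Polynomial.natDegree_derivative,
      Polynomial.derivative_map, Polynomial.resultant_map_map, h, map_zero] at h1
    exact h1 rfl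
  obtain ⟨a, b, -, -, hab⟩ := Polynomial.exists_mul_add_mul_eq_C_resultant p p.derivative
    le_rfl le_rfl (Or.inl h0)
  have h2 : ψ (p.resultant p.derivative) ≠ 0 := (map_ne_zero_iff ψ hψ).2 hr
  have h3 := congrArg (Polynomial.map ψ) hab
  rw [Polynomial.map_add, Polynomial.map_mul, Polynomial.map_mul, Polynomial.map_C] at h3
  refine ⟨Polynomial.C (ψ (p.resultant p.derivative))⁻¹ * a.map ψ,
    Polynomial.C (ψ (p.resultant p.derivative))⁻¹ * b.map ψ, ?_⟩
  rw [Polynomial.derivative_map]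
  calc _ = Polynomial.C (ψ (p.resultant p.derivative))⁻¹ *
        (p.map ψ * a.map ψ + p.derivative.map ψ * b.map ψ) := by ring
    _ = 1 := by rw [h3, ← Polynomial.C_mul, inv_mul_cancel₀ h2, Polynomial.C_1]

/-- A split separable characteristic polynomial has `n` distinct roots; eigenvectors for them are
independent and form the columns of `P`. -/
theorem Matrix.exists_mul_eq_mul_diagonal {L : Type*} [Field L] {n : ℕ}
    (M : Matrix (Fin n) (Fin n) L) (hsep : M.charpoly.Separable) (hspl : M.charpoly.Splits) :
    ∃ (P : Matrix (Fin n) (Fin n) L) (μ : Fin n → L), P.det ≠ 0 ∧ Function.Injective μ ∧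
      M * P = P * Matrix.diagonal μ := by
  classical
  have hcard : M.charpoly.roots.toFinset.card = n := by
    rw [Multiset.toFinset_card_of_nodup (Polynomial.nodup_roots hsep),
      ← hspl.natDegree_eq_card_roots, Matrix.charpoly_natDegree_eq_dim, Fintype.card_fin]
  let e := (M.charpoly.roots.toFinset.equivFinOfCardEq hcard).symm
  let μ : Fin n → L := fun i => e i
  have hμ : Function.Injective μ := Subtype.val_injective.comp e.injective
  have hroot : ∀ i, ∃ v : Fin n → L, v ≠ 0 ∧ M.mulVec v = μ i • v := by
    intro i
    have h1 : M.charpoly.eval (μ i) = 0 := by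
      have := (e i).2
      rw [Multiset.mem_toFinset, Polynomial.mem_roots'] at this
      exact this.2
    rw [Matrix.eval_charpoly] at h1
    obtain ⟨v, hv, h2⟩ := Matrix.exists_mulVec_eq_zero_iff.2 h1
    refine ⟨v, hv, ?_⟩
    rw [Matrix.sub_mulVec, sub_eq_zero] at h2
    rw [← h2, Matrix.scalar_apply, ← Matrix.smul_one_eq_diagonal, Matrix.smul_mulVec,
      Matrix.one_mulVec]
  choose v hv hMv using hroot
  have hlin : LinearIndependent L v := by
    refine Module.End.eigenvectors_linearIndependent' (Matrix.toLin' M) μ hμ v fun i => ?_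
    exact ⟨Module.End.mem_eigenspace_iff.2 (by rw [Matrix.toLin'_apply, hMv]), hv i⟩
  refine ⟨(Matrix.of v).transpose, μ, ?_, hμ, ?_⟩
  · have := Matrix.linearIndependent_rows_iff_isUnit (A := Matrix.of v) |>.1 hlin
    rw [Matrix.det_transpose]
    exact ((Matrix.isUnit_iff_isUnit_det _).1 this).ne_zero
  · ext i k
    rw [Matrix.mul_diagonal, Matrix.mul_apply]
    have := congrFun (hMv k) i
    simp only [Matrix.mulVec, dotProduct, Pi.smul_apply, smul_eq_mul] at this
    simp [this, mul_comm]

/-- The determinant of the Krylov matrix of a diagonalized matrix. -/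
theorem det_krylov_of_mul_eq_mul_diagonal {R : Type*} [CommRing R] {n : ℕ}
    {M P : Matrix (Fin n) (Fin n) R} {μ : Fin n → R} (h : M * P = P * Matrix.diagonal μ)
    (w : Fin n → R) :
    (Matrix.of fun i j : Fin n => (M ^ (j : ℕ)).mulVec (P.mulVec w) i).det =
      P.det * (∏ k, w k) * (Matrix.vandermonde μ).det := by
  have hpow : ∀ j : ℕ, M ^ j * P = P * Matrix.diagonal (μ ^ j) := by
    intro j
    induction j with
    | zero => simp
    | succ j ih =>
      rw [pow_succ, mul_assoc, h, ← mul_assoc, ih, mul_assoc, Matrix.diagonal_mul_diagonal, pow_succ]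
      rfl
  have : (Matrix.of fun i j : Fin n => (M ^ (j : ℕ)).mulVec (P.mulVec w) i) =
      P * Matrix.diagonal w * Matrix.vandermonde μ := by
    ext i j
    rw [Matrix.of_apply, Matrix.mulVec_mulVec, hpow, Matrix.mul_assoc, Matrix.mul_apply,
      Matrix.mulVec, dotProduct]
    refine Finset.sum_congr rfl fun k _ => ?_
    rw [Matrix.mul_diagonal, Matrix.diagonal_mul, Matrix.vandermonde_apply, Pi.pow_apply]
    ring
  rw [this, Matrix.det_mul, Matrix.det_mul, Matrix.det_diagonal]

/-- At `M = diag(0, …, n-1)` and `v = (1, …, 1)` the value is a Vandermonde determinant with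
distinct nodes. -/
theorem cyclicDet_ne_zero (n : ℕ) : cyclicDet n ≠ 0 := by
  intro h
  let ε : MvPolynomial (PairCoord n) ℂ →+* ℂ := MvPolynomial.eval
    (Sum.elim (fun ij => Matrix.diagonal (fun i : Fin n => ((i : ℕ) : ℂ)) ij.1 ij.2) fun _ => 1)
  have hM : ε.mapMatrix (genericMatrix n) = Matrix.diagonal fun i : Fin n => ((i : ℕ) : ℂ) := by
    ext i j
    simp [ε, genericMatrix]
  have hv : ∀ i, ε (genericVector n i) = 1 := by
    intro i
    simp [ε, genericVector]
  have h1 := congrArg ε h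
  rw [cyclicDet, RingHom.map_det, map_zero] at h1
  have h2 : ε.mapMatrix (cyclicMatrix n) =
      Matrix.of fun i j : Fin n => ((Matrix.diagonal fun i : Fin n => ((i : ℕ) : ℂ)) ^
        (j : ℕ)).mulVec ((1 : Matrix (Fin n) (Fin n) ℂ).mulVec 1) i := by
    ext i j
    rw [← hM, Matrix.of_apply, ← map_pow, Matrix.one_mulVec]
    simp [cyclicMatrix, Matrix.mulVec, dotProduct, hv]
  rw [h2, det_krylov_of_mul_eq_mul_diagonal (μ := fun i : Fin n => ((i : ℕ) : ℂ)) (by simp)] at h1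
  have h3 : (Matrix.vandermonde fun i : Fin n => ((i : ℕ) : ℂ)).det ≠ 0 :=
    Matrix.det_vandermonde_ne_zero_iff.2 (Nat.cast_injective.comp Fin.val_injective)
  simp [h3] at h1

end Diagonalization

/-- Derivations extend to finite extensions in characteristic zero. -/
theorem exists_derivation_extending {A K L : Type*} [CommRing A] [Field K] [CharZero K] [Algebra A K]
    [Field L] [Algebra K L] [FiniteDimensional K L] (d : Derivation A K K) :
    ∃ D : Derivation ℤ L L, ∀ x : K, D (algebraMap K L x) = algebraMap K L (d x) := by
  let _ : Differential K := ⟨Derivation.mk' (d : K →ₗ[A] K).toAddMonoidHom.toIntLinearMap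
    fun a b => d.leibniz a b⟩
  let _ : Differential L := Differential.differentialFiniteDimensional K L
  have : DifferentialAlgebra K L := Differential.differentialAlgebraFiniteDimensional
  exact ⟨Differential.deriv, fun x => DifferentialAlgebra.deriv_algebraMap x⟩

/-- The generic matrix is diagonalizable with distinct eigenvalues over a field to which the partial
derivatives in the matrix entries extend. -/
theorem exists_differential_diagonalization (n : ℕ) :
    ∃ (L : Type) (_ : Field L) (ι : ℂ →+* L) (M P : Matrix (Fin n) (Fin n) L) (μ : Fin n → L)
      (δ : Fin n × Fin n → Derivation ℤ L L),
      P.det ≠ 0 ∧ Function.Injective μ ∧ M * P = P * Matrix.diagonal μ ∧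
      (∀ s c, δ s (ι c) = 0) ∧ ∀ s i j, δ s (M i j) = if s = (i, j) then 1 else 0 := by
  classical
  let A := MvPolynomial (Fin n × Fin n) ℂ
  let K := FractionRing A
  let MA : Matrix (Fin n) (Fin n) A := Matrix.mvPolynomialX (Fin n) (Fin n) ℂ
  let p : Polynomial K := MA.charpoly.map (algebraMap A K)
  -- The splitting field is finite over `K`, so the partial derivatives extend to it.
  let L := p.SplittingField
  -- Separability is tested at `diag(0, …, n-1)`, whose eigenvalues are distinct.
  have hsepK : p.Separable := by
    refine Polynomial.separable_map_of_separable_map MA.charpoly_monic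
      (MvPolynomial.eval fun ij =>
        Matrix.diagonal (fun i : Fin n => ((i : ℕ) : ℂ)) ij.1 ij.2) ?_ _
        (IsFractionRing.injective A K)
    rw [← Matrix.charpoly_map]
    have : MA.map (MvPolynomial.eval fun ij : Fin n × Fin n =>
        Matrix.diagonal (fun i : Fin n => ((i : ℕ) : ℂ)) ij.1 ij.2) =
        Matrix.diagonal fun i : Fin n => ((i : ℕ) : ℂ) := by
      ext i j
      simp [MA]
    rw [this, Matrix.charpoly_diagonal, Polynomial.separable_prod_X_sub_C_iff]
    exact Nat.cast_injective.comp Fin.val_injective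
  let M : Matrix (Fin n) (Fin n) L := MA.map fun x => algebraMap K L (algebraMap A K x)
  have hM : M.charpoly = p.map (algebraMap K L) := by
    rw [Polynomial.map_map, ← Matrix.charpoly_map]
    rfl
  obtain ⟨P, μ, hP, hμ, hMP⟩ := M.exists_mul_eq_mul_diagonal (hM ▸ hsepK.map)
    (hM ▸ Polynomial.SplittingField.splits p)
  choose δ hδ using fun s : Fin n × Fin n => exists_derivation_extending (K := K) (L := L) (fracDeriv ℂ s)
  refine ⟨L, inferInstance, (algebraMap K L).comp ((algebraMap A K).comp (algebraMap ℂ A)), M, P, μ,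
    δ, hP, hμ, hMP, ?_, ?_⟩
  · intro s c
    rw [RingHom.comp_apply, RingHom.comp_apply, hδ, fracDeriv_algebraMap,
      Derivation.map_algebraMap, map_zero, map_zero]
  · intro s i j
    change δ s (algebraMap K L (algebraMap A K (MvPolynomial.X (i, j)))) = _
    rw [hδ, fracDeriv_algebraMap, MvPolynomial.pderiv_X, Pi.single_apply]
    simp only [eq_comm]
    split_ifs <;> simp

/-! ### Divisibility by `(s + 1)^n` -/

section Divisibility

variable {L : Type*} [Field L] {n : ℕ}

/-- The constants `L` inside the Laurent polynomials over `L[s]`. -/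
def laurentConst (L : Type*) [Field L] (n : ℕ) :
    L →+* AddMonoidAlgebra (Polynomial L) (Fin n → ℤ) :=
  AddMonoidAlgebra.singleZeroRingHom.comp Polynomial.C

theorem laurentConst_apply (x : L) :
    laurentConst L n x = AddMonoidAlgebra.single 0 (Polynomial.C x) := rfl

/-- The Laurent variables. -/
def laurentVar (L : Type*) [Field L] (n : ℕ) (k : Fin n) :
    AddMonoidAlgebra (Polynomial L) (Fin n → ℤ) :=
  AddMonoidAlgebra.single (Pi.single k 1) 1

theorem prod_laurentVar : ∏ k, laurentVar L n k = AddMonoidAlgebra.single 1 1 := by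
  classical
  have : ∀ s : Finset (Fin n), ∏ k ∈ s, laurentVar L n k =
      AddMonoidAlgebra.single (∑ k ∈ s, Pi.single k 1) 1 := by
    intro s
    induction s using Finset.induction_on with
    | empty => rfl
    | insert k s hk ih =>
      rw [Finset.prod_insert hk, Finset.sum_insert hk, ih, laurentVar,
        AddMonoidAlgebra.single_mul_single, one_mul]
  have h1 : ∑ k : Fin n, Pi.single k (1 : ℤ) = (1 : Fin n → ℤ) := by
    ext i
    simp [Finset.sum_apply, Pi.single_apply]
  rw [this, h1]

/-- Coefficientwise extension of a derivation to polynomials. -/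
theorem exists_derivation_polynomial {A : Type*} [CommRing A] (δ : Derivation ℤ A A) :
    ∃ Δ : Polynomial A →+ Polynomial A, IsLeibniz Δ ∧ ∀ p i, (Δ p).coeff i = δ (p.coeff i) := by
  let _ : Differential A := ⟨δ⟩
  exact ⟨Differential.mapCoeffs.toLinearMap.toAddMonoidHom,
    fun a b => Differential.mapCoeffs.leibniz a b, Differential.coeff_mapCoeffs⟩

theorem laurentConst_mem_poleSubring (t : Polynomial L) (x : L) :
    laurentConst L n x ∈ poleSubring t :=
  single_mem_poleSubring.2 (by rw [negCount_eq_zero le_rfl, pow_zero]; exact one_dvd _)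

theorem laurentVar_mem_poleSubring (t : Polynomial L) (k : Fin n) :
    laurentVar L n k ∈ poleSubring t :=
  single_mem_poleSubring.2 (by
    rw [negCount_eq_zero (Pi.single_nonneg.2 zero_le_one), pow_zero])

/-- A derivation of the Laurent polynomials over `L[s]` that extends a given derivation `δ` of `L`
and has prescribed values `e` on the linear forms `P w`. -/
theorem exists_laurent_derivation (δ : Derivation ℤ L L) {P : Matrix (Fin n) (Fin n) L}
    (hP : P.det ≠ 0) (e : Fin n → L) :
    ∃ D : AddMonoidAlgebra (Polynomial L) (Fin n → ℤ) →+
        AddMonoidAlgebra (Polynomial L) (Fin n → ℤ), IsLeibniz D ∧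
      (∀ x, D (laurentConst L n x) = laurentConst L n (δ x)) ∧
      (∀ p : Polynomial L, (∀ i, δ (p.coeff i) = 0) → D (AddMonoidAlgebra.single 0 p) = 0) ∧
      (∀ i, D ((P.map (laurentConst L n)).mulVec (laurentVar L n) i) = laurentConst L n (e i)) ∧
      (∀ g ∈ poleSubring (Polynomial.X + 1), D g ∈ poleSubring (Polynomial.X + 1)) ∧
      ∀ u : L, u ≠ 0 → AddMonoidAlgebra.single 0 (Polynomial.X + 1) *
        (D (AddMonoidAlgebra.single 1 (Polynomial.C u)) *
          AddMonoidAlgebra.single (-1) (Polynomial.C u⁻¹)) ∈ poleSubring (Polynomial.X + 1) := by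
  classical
  obtain ⟨Δ, hΔL, hΔ⟩ := exists_derivation_polynomial δ
  have hΔC : ∀ x, Δ (Polynomial.C x) = Polynomial.C (δ x) := by
    intro x
    ext i
    rw [hΔ, Polynomial.coeff_C, Polynomial.coeff_C]
    split_ifs <;> simp
  have hΔ0 : ∀ p : Polynomial L, (∀ i, δ (p.coeff i) = 0) → Δ p = 0 := by
    intro p hp
    ext i
    rw [hΔ, hp, Polynomial.coeff_zero]
  have hδ01 : ∀ (Q : Prop) [Decidable Q], δ (if Q then 1 else 0) = 0 := by
    intro Q _
    split_ifs <;> simp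
  have hΔt : Δ (Polynomial.X + 1) = 0 := hΔ0 _ fun i => by
    rw [Polynomial.coeff_add, map_add, Polynomial.coeff_X, Polynomial.coeff_one, hδ01, hδ01,
      add_zero]
  -- The only possible value of `D w`: differentiating `P w` must give `e = δ(P) w + P (D w)`. It is
  -- polynomial in `w`, hence has no poles.
  let c : Fin n → AddMonoidAlgebra (Polynomial L) (Fin n → ℤ) :=
    (P⁻¹.map (laurentConst L n)).mulVec
      ((fun i => laurentConst L n (e i)) -
        (P.map fun x => laurentConst L n (δ x)).mulVec (laurentVar L n))
  have hc : ∀ i, c i ∈ poleSubring (Polynomial.X + 1 : Polynomial L) := by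
    intro i
    refine Subring.sum_mem _ fun k _ => Subring.mul_mem _ (laurentConst_mem_poleSubring _ _)
      (Subring.sub_mem _ (laurentConst_mem_poleSubring _ _) (Subring.sum_mem _ fun l _ =>
        Subring.mul_mem _ (laurentConst_mem_poleSubring _ _) (laurentVar_mem_poleSubring _ _)))
  let D := groupAlgebraDeriv Δ (logDerivHom c)
  have hDconst : ∀ p, D (AddMonoidAlgebra.single 0 p) = AddMonoidAlgebra.single 0 (Δ p) := by
    intro p
    rw [groupAlgebraDeriv_single, map_zero, mul_zero, add_zero]
  have hDvar : ∀ k, D (laurentVar L n k) = c k := by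
    intro k
    rw [laurentVar, groupAlgebraDeriv_single, hΔL.map_one,
      AddMonoidAlgebra.single_zero, zero_add, logDerivHom_apply, Finset.sum_eq_single k]
    · rw [Pi.single_eq_same, one_smul, ← mul_assoc, AddMonoidAlgebra.single_mul_single,
        add_neg_cancel, mul_one, ← AddMonoidAlgebra.one_def, one_mul]
    · intro l _ hl
      rw [Pi.single_eq_of_ne hl, zero_smul]
    · simp
  have hDL : IsLeibniz D := isLeibniz_groupAlgebraDeriv hΔL _
  refine ⟨D, hDL, fun x => ?_, fun p hp => ?_, fun i => ?_,
    fun g hg => groupAlgebraDeriv_mem_poleSubring hΔL hΔt hc hg, fun u hu => ?_⟩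
  · rw [laurentConst_apply, hDconst, hΔC]
    rfl
  · rw [hDconst, hΔ0 p hp, AddMonoidAlgebra.single_zero]
  · have h1 : D ((P.map (laurentConst L n)).mulVec (laurentVar L n) i) =
        (P.map (laurentConst L n)).mulVec c i +
          (P.map fun x => laurentConst L n (δ x)).mulVec (laurentVar L n) i := by
      simp only [Matrix.mulVec, dotProduct, map_sum, hDL _ _,
        Matrix.map_apply, ← Finset.sum_add_distrib]
      refine Finset.sum_congr rfl fun k _ => ?_
      rw [hDvar, laurentConst_apply, hDconst, hΔC, ← laurentConst_apply, ← laurentConst_apply,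
        mul_comm (laurentVar L n k)]
    have h2 : (P.map (laurentConst L n)).mulVec c = (fun i => laurentConst L n (e i)) -
        (P.map fun x => laurentConst L n (δ x)).mulVec (laurentVar L n) := by
      simp only [c]
      rw [Matrix.mulVec_mulVec, ← Matrix.map_mul, Matrix.mul_nonsing_inv _ (isUnit_iff_ne_zero.2 hP),
        Matrix.map_one _ (map_zero _) (map_one _), Matrix.one_mulVec]
    rw [h1, h2, Pi.sub_apply, sub_add_cancel]
  · exact groupAlgebraDeriv_log_mem_poleSubring Δ hc
      (by rw [← Polynomial.C_mul, mul_inv_cancel₀ hu, Polynomial.C_1]) 1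

/-- In the eigenbasis coordinates `f` becomes `u ∏ w_k`, so `b/f` has a pole along all `n`
coordinate hyperplanes and each costs a factor `s + 1`. -/
theorem pow_dvd_of_satisfiesBernsteinEquation {b : Polynomial ℂ}
    (hb : SatisfiesBernsteinEquation (cyclicDet n) b) : (Polynomial.X + 1) ^ n ∣ b := by
  classical
  obtain ⟨L, _, ι, M, P, μ, δ, hP, hμ, hMP, hδι, hδM⟩ := exists_differential_diagonalization n
  let R := AddMonoidAlgebra (Polynomial L) (Fin n → ℤ)
  let t : Polynomial L := Polynomial.X + 1
  let κ := laurentConst L n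
  let y : Fin n → R := (P.map κ).mulVec (laurentVar L n)
  let Θ : MvPolynomial (PairCoord n) (Polynomial ℂ) →+* R := MvPolynomial.eval₂Hom
    (AddMonoidAlgebra.singleZeroRingHom.comp (Polynomial.mapRingHom ι))
    (Sum.elim (fun ij => κ (M ij.1 ij.2)) y)
  have hΘC : ∀ p, Θ (MvPolynomial.C p) = AddMonoidAlgebra.single 0 (p.map ι) := fun p => by
    simp [Θ]
  have hΘX : ∀ s, Θ (MvPolynomial.X s) = Sum.elim (fun ij => κ (M ij.1 ij.2)) y s := fun s => by
    simp [Θ]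
  let u := P.det * (Matrix.vandermonde μ).det
  have hu : u ≠ 0 := mul_ne_zero hP (Matrix.det_vandermonde_ne_zero_iff.2 hμ)
  have hΘf : Θ (withS (cyclicDet n)) = AddMonoidAlgebra.single 1 (Polynomial.C u) := by
    let Θ' : MvPolynomial (PairCoord n) ℂ →+* R := Θ.comp (MvPolynomial.map Polynomial.C)
    have hM : Θ'.mapMatrix (genericMatrix n) = M.map κ := by
      ext1 i j
      simp [Θ', genericMatrix, hΘX]
    have hv : ∀ i, Θ' (genericVector n i) = y i := by
      intro i
      simp [Θ', genericVector, hΘX]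
    have hmat : Θ'.mapMatrix (cyclicMatrix n) =
        Matrix.of fun i j : Fin n => ((M.map κ) ^ (j : ℕ)).mulVec y i := by
      ext1 i j
      rw [← hM, Matrix.of_apply, ← map_pow]
      simp [cyclicMatrix, Matrix.mulVec, dotProduct, hv]
    have hdiag : M.map κ * P.map κ = P.map κ * Matrix.diagonal fun i => κ (μ i) := by
      rw [← Matrix.map_mul, hMP, Matrix.map_mul, Matrix.diagonal_map (map_zero κ)]
    have hvand : (Matrix.vandermonde fun i => κ (μ i)) = κ.mapMatrix (Matrix.vandermonde μ) := by
      ext1 i j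
      simp [Matrix.vandermonde_apply]
    change Θ' (cyclicDet n) = _
    rw [cyclicDet, RingHom.map_det, hmat, det_krylov_of_mul_eq_mul_diagonal hdiag, hvand,
      ← RingHom.mapMatrix_apply, ← RingHom.map_det, ← RingHom.map_det, prod_laurentVar,
      mul_right_comm, ← map_mul]
    change AddMonoidAlgebra.single 0 (Polynomial.C u) * _ = _
    rw [AddMonoidAlgebra.single_mul_single, zero_add, mul_one]
  -- These data lift the partial derivatives: those in the matrix entries act on `L` through `δ` and
  -- kill `v = P w`; those in the vector entries vanish on `L` and send `v` to a basis vector.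
  let δ' : PairCoord n → Derivation ℤ L L := Sum.elim δ 0
  let e : PairCoord n → Fin n → L := Sum.elim 0 fun i => Pi.single i 1
  have hδ'ι : ∀ s c, δ' s (ι c) = 0 := by
    rintro (s | s) c
    · exact hδι s c
    · rfl
  choose D hDL hDκ hDC hDy hDN hDlog using fun s => exists_laurent_derivation (δ' s) hP (e s)
  have hDX : ∀ s s', D s (Θ (MvPolynomial.X s')) = Θ (MvPolynomial.pderiv s (MvPolynomial.X s')) := by
    intro s s'
    rw [hΘX, MvPolynomial.pderiv_X, Pi.single_apply]
    have h01 : ∀ (Q : Prop) [Decidable Q],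
        Θ (if Q then 1 else 0) = κ (if Q then 1 else 0) := by
      intro Q _
      split_ifs <;> simp
    rw [h01]
    rcases s' with ⟨i, j⟩ | i
    · refine (hDκ s _).trans (congrArg κ ?_)
      rcases s with s | s
      · simp only [δ', Sum.elim_inl, hδM, Sum.inl.injEq, eq_comm]
      · simp [δ']
    · refine (hDy s i).trans (congrArg κ ?_)
      rcases s with s | s
      · simp [e]
      · simp [e, Pi.single_apply]
  have hD : ∀ s g, D s (Θ g) = Θ (MvPolynomial.pderiv s g) := by
    intro s g
    induction g using MvPolynomial.induction_on with
    | C p =>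
      rw [MvPolynomial.pderiv_C, map_zero, hΘC]
      exact hDC s _ fun i => by rw [Polynomial.coeff_map, hδ'ι]
    | add p q hp hq => rw [map_add, map_add, hp, hq, map_add, map_add]
    | mul_X p i hp =>
      rw [map_mul, hDL, Derivation.leibniz, hp, hDX, map_add]
      simp only [smul_eq_mul, map_mul]
  have hΘN : ∀ g, Θ g ∈ poleSubring t := by
    intro g
    induction g using MvPolynomial.induction_on with
    | C p =>
      rw [hΘC, single_mem_poleSubring, negCount_eq_zero le_rfl, pow_zero]
      exact one_dvd _
    | add p q hp hq => rw [map_add]; exact Subring.add_mem _ hp hq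
    | mul_X p i hp =>
      rw [map_mul, hΘX]
      refine Subring.mul_mem _ hp ?_
      rcases i with i | i
      · exact laurentConst_mem_poleSubring _ _
      · change ∑ k, κ (P i k) * laurentVar L n k ∈ _
        exact Subring.sum_mem _ fun k _ => Subring.mul_mem _ (laurentConst_mem_poleSubring _ _)
          (laurentVar_mem_poleSubring _ _)
  have key := mem_of_satisfiesBernsteinEquation Θ
    (v := AddMonoidAlgebra.single (-1) (Polynomial.C u⁻¹))
    (by rw [hΘf, AddMonoidAlgebra.single_mul_single, ← Polynomial.C_mul, mul_inv_cancel₀ hu,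
      add_neg_cancel, Polynomial.C_1]; rfl) D hDL hD (poleSubring t) hΘN hDN
    (fun s => by
      rw [hΘf, hΘC]
      simpa using hDlog s u hu) hb
  rw [hΘC, AddMonoidAlgebra.single_mul_single, zero_add, single_mem_poleSubring] at key
  have hn : negCount (-1 : Fin n → ℤ) = n := by simp [negCount]
  rw [hn, (Polynomial.isUnit_C.2 (inv_ne_zero hu).isUnit).dvd_mul_right] at key
  -- Divisibility was obtained over `L`; it descends along the field embedding `ι`.
  rw [← Polynomial.map_dvd_map' ι]
  simpa using key

end Divisibility

theorem mainTheorem6 (n : ℕ) :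
    (∃! b : Polynomial ℂ, IsBFunction (cyclicDet n) b) ∧
      ∀ b : Polynomial ℂ, IsBFunction (cyclicDet n) b → bOne n ∣ b := by
  constructor
  · obtain ⟨b, hb, h⟩ := exists_satisfiesBernsteinEquation (cyclicDet_ne_zero n)
    exact existsUnique_isBFunction _ hb h
  · intro b hb
    rw [bOne, IsUnit.mul_left_dvd]
    · exact pow_dvd_of_satisfiesBernsteinEquation hb.equation
    · exact Polynomial.isUnit_C.2 (Nat.cast_ne_zero.2 n.factorial_ne_zero).isUnit

end
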